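/- **Theorem 2.** Let $N\ge 1$ and consider the system with states $x_i(t)\in X_i\subseteq\mathbb R^n$, $i=1,\dots,N$, $$\dot x_i=f_i(z_i)+g_i(z_i)x_{i+1}+w_i\ (1\le i\le N-1),\qquad \dot x_N=f_N(z_N)+g_N(z_N)u+w_N,\qquad y=x_1,$$ where $z_i=(x_1,\dots,x_i)\in\overline X_i=X_1\times\dots\times X_i$, the disturbances $w_i$ are measurable in $t\ge 0$ with values in a bounded set $W\subset\mathbb R^n$, the maps $f_i:\overline X_i\to\mathbb R^n$ and $g_i:\overline X_i\to\mathbb R^{n\times n}$ are locally Lipschitz, and for every $i$ there is a constant $\underline g_i>0$ with $\lambda_{\min}\big(\tfrac12(g_i(z)+g_i(z)^\top)\big)\ge\underline g_i$ for all $z\in\overline X_i$. Trajectories are understood in the Carathéodory (integral) sense. Let $Y=X_1$. A T-RAS task consists of a time $t_c>0$, unsafe sets $U(t)\subseteq Y$ ($t\ge0$), an initial set $S\subseteq Y\setminus U(0)$ and a target set $T\subseteq Y\setminus U(t_c)$; an output $y$ satisfies it if $y(0)\in S$, $y(t_c)\in T$ and $y(s)\in Y\setminus U(s)$ for all $s\in[0,t_c]$.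 Let $c:[0,\infty)\to\mathbb R^n$ and $r:[0,\infty)\to\mathbb R$ be continuously differentiable, with $r>0$ on $[0,t_c]$, and suppose that the tube $\Gamma(t)=\{x:\|x-c(t)\|\le r(t)\}$ satisfies $\Gamma(0)\subseteq S$, $\Gamma(t_c)\subseteq T$ and $\Gamma(t)\subseteq Y\setminus U(t)$ for all $t\in[0,t_c]$. Controller. Let $\kappa_k>0$, $p_{k,i}>q_{k,i}>0$, $\mu_{k,i}\ge0$ and $\gamma_{k,i}(t)=(p_{k,i}-q_{k,i})e^{-\mu_{k,i}t}+q_{k,i}$. Put $e_1=\|x_1-c(t)\|/r(t)$, $\varepsilon_1=\ln\frac{1+e_1}{1-e_1}$ and $r_2=-\kappa_1\varepsilon_1\,(x_1-c(t))$. For $k=2,\dots,N$ put $e_{k,i}=(x_{k,i}-r_{k,i})/\gamma_{k,i}(t)$, $\varepsilon_{k,i}=\ln\frac{1+e_{k,i}}{1-e_{k,i}}$, $\xi_k=4\,\mathrm{diag}(\gamma_{k,1},\dots,\gamma_{k,n})^{-1}\big(I_n-\mathrm{diag}(e_k\circ e_k)\big)^{-1}$ and $r_{k+1}=-\kappa_k\xi_k\varepsilon_k$.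 The control input is $u=r_{N+1}$. The controller is well defined where $e_1<1$ and $|e_{k,i}|<1$ for all $k,i$. Let the initial state satisfy $x_k(0)\in X_k$ for all $k$, $\|y(0)-c(0)\|<r(0)$, and $|x_{k,i}(0)-r_{k,i}(0)|<p_{k,i}$ for $k=2,\dots,N$ and $i=1,\dots,n$. Then: 1. Along every closed-loop trajectory on an interval $[0,t_1]$ with $0\le t_1\le t_c$, the controller is well defined and $y(t)\in\Gamma(t)$ for all $t\in[0,t_1]$. In particular, if $t_1=t_c$, then $y$ satisfies the T-RAS task. 2. If $x_k(0)$ is an interior point of $X_k$ for every $k\ge2$, then a closed-loop trajectory exists on all of $[0,t_c]$, unless there are $\tau\in(0,t_c]$, a closed-loop trajectory on $[0,\tau)$ and an index $k\ge2$ such that $x_k(t)$ has, as $t\to\tau^-$, an accumulation point outside the interior of $X_k$. In particular, if $X_k=\mathbb R^n$ for all $k\ge 2$, then a closed-loop trajectory exists on $[0,t_c]$, and by 1 it satisfies the T-RAS task. -/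

import Mathlib

open Set Filter Topology MeasureTheory

noncomputable section

namespace TubeControl

/-- `ℝⁿ` with the Euclidean norm. -/
abbrev Vec (n : ℕ) := EuclideanSpace ℝ (Fin n)

/-! ### The system -/

/-- The data of a pure-feedback system of `N` stages with `n`-dimensional blocks. Indices start
at `0`: `X i`, `f i`, `g i` belong to the state block `x_{i+1}` in one-based notation. The maps
`f i`, `g i` take the first `i + 1` state blocks; only their values on `S.dom i` matter. -/
structure PureFeedbackSystem (N n : ℕ) where
  /-- the state sets -/
  X : Fin N → Set (Vec n)
  /-- the drift terms -/
  f : (i : Fin N) → (Fin ((i : ℕ) + 1) → Vec n) → Vec n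
  /-- the input matrices -/
  g : (i : Fin N) → (Fin ((i : ℕ) + 1) → Vec n) → Matrix (Fin n) (Fin n) ℝ
  /-- the set of disturbance values -/
  W : Set (Vec n)

/-- The first `i + 1` blocks of a state. -/
def trunc {N n : ℕ} (i : Fin N) (x : Fin N → Vec n) : Fin ((i : ℕ) + 1) → Vec n :=
  fun j => x (Fin.castLE i.isLt j)

/-- The product of the first `i + 1` state sets: the domain of `f i` and `g i`. -/
def PureFeedbackSystem.dom {N n : ℕ} (S : PureFeedbackSystem N n) (i : Fin N) :
    Set (Fin ((i : ℕ) + 1) → Vec n) :=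
  {z | ∀ j, z j ∈ S.X (Fin.castLE i.isLt j)}

/-- All `f i` and (entrywise, hence in any matrix norm) all `g i` are locally Lipschitz on their
domains. -/
def PureFeedbackSystem.LocLipschitz {N n : ℕ} (S : PureFeedbackSystem N n) : Prop :=
  ∀ i, LocallyLipschitzOn (S.dom i) (S.f i) ∧
    ∀ a b, LocallyLipschitzOn (S.dom i) (fun z => S.g i z a b)

/-- The symmetric part of a square matrix. -/
def symmPart {n : ℕ} (A : Matrix (Fin n) (Fin n) ℝ) : Matrix (Fin n) (Fin n) ℝ :=
  (2 : ℝ)⁻¹ • (A + A.transpose)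

theorem isHermitian_symmPart {n : ℕ} (A : Matrix (Fin n) (Fin n) ℝ) :
    (symmPart A).IsHermitian := by
  ext a b
  simp only [symmPart, Matrix.conjTranspose_apply, Matrix.smul_apply, Matrix.add_apply,
    Matrix.transpose_apply, star_trivial, add_comm (A b a)]

/-- The smallest eigenvalue of the symmetric part of `g i` is bounded below by a positive constant
on the whole domain. -/
def PureFeedbackSystem.UniformlyPosDef {N n : ℕ} (S : PureFeedbackSystem N n) : Prop :=
  ∀ i, ∃ b : ℝ, 0 < b ∧ ∀ z ∈ S.dom i, ∀ j, b ≤ (isHermitian_symmPart (S.g i z)).eigenvalues j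

/-! ### Temporal reach-avoid-stay tasks and tubes -/

/-- A temporal reach-avoid-stay task in the output space `Y`. -/
structure TRASTask {n : ℕ} (Y : Set (Vec n)) where
  /-- the prescribed time -/
  tc : ℝ
  /-- the time-varying unsafe set -/
  unsafeSet : ℝ → Set (Vec n)
  /-- the initial set -/
  initial : Set (Vec n)
  /-- the target set -/
  target : Set (Vec n)
  tc_pos : 0 < tc
  unsafeSet_subset : ∀ t, 0 ≤ t → unsafeSet t ⊆ Y
  initial_subset : initial ⊆ Y \ unsafeSet 0
  target_subset : target ⊆ Y \ unsafeSet tc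

/-- The output `y` satisfies the task. -/
def TRASTask.Satisfies {n : ℕ} {Y : Set (Vec n)} (τ : TRASTask Y) (y : ℝ → Vec n) : Prop :=
  y 0 ∈ τ.initial ∧ y τ.tc ∈ τ.target ∧ ∀ s ∈ Icc 0 τ.tc, y s ∈ Y \ τ.unsafeSet s

/-- The time-varying closed ball with center `c t` and radius `r t`. -/
def tube {n : ℕ} (c : ℝ → Vec n) (r : ℝ → ℝ) (t : ℝ) : Set (Vec n) :=
  {x | ‖x - c t‖ ≤ r t}

/-- The ball with center `c` and radius `r` is a spatiotemporal tube for the task. -/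
structure IsSTT {n : ℕ} {Y : Set (Vec n)} (τ : TRASTask Y) (c : ℝ → Vec n) (r : ℝ → ℝ) :
    Prop where
  contDiff_center : ContDiffOn ℝ 1 c (Ici 0)
  contDiff_radius : ContDiffOn ℝ 1 r (Ici 0)
  radius_pos : ∀ t ∈ Icc 0 τ.tc, 0 < r t
  initial : tube c r 0 ⊆ τ.initial
  target : tube c r τ.tc ⊆ τ.target
  safe : ∀ t ∈ Icc 0 τ.tc, tube c r t ⊆ Y \ τ.unsafeSet t

/-! ### The controller

It depends only on the tube and on the design parameters, not on the system. -/

/-- Design parameters: the gains `κ` of all stages, and the parameters `p`, `q`, `μ` of the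
performance bounds (those at index `0` are not used). -/
structure Design (N n : ℕ) where
  κ : Fin N → ℝ
  p : Fin N → Fin n → ℝ
  q : Fin N → Fin n → ℝ
  μ : Fin N → Fin n → ℝ
  κ_pos : ∀ k, 0 < κ k
  q_pos : ∀ k i, 0 < q k i
  q_lt_p : ∀ k i, q k i < p k i
  μ_nonneg : ∀ k i, 0 ≤ μ k i

/-- The performance bound `(p - q) exp (-μ t) + q`. -/
def Design.γ {N n : ℕ} (D : Design N n) (k : Fin N) (t : ℝ) (i : Fin n) : ℝ :=
  (D.p k i - D.q k i) * Real.exp (-D.μ k i * t) + D.q k i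

/-- The transformation `ln ((1 + e) / (1 - e))`, meant for `-1 < e < 1`. -/
def transf (e : ℝ) : ℝ := Real.log ((1 + e) / (1 - e))

/-- Normalized output error (first stage). -/
def outErr {n : ℕ} (c : ℝ → Vec n) (r : ℝ → ℝ) (t : ℝ) (x : Vec n) : ℝ := ‖x - c t‖ / r t

/-- Normalized error of a later stage, `diag (γ)⁻¹ (x - ref)`. -/
def Design.err {N n : ℕ} (D : Design N n) (k : Fin N) (t : ℝ) (x ref : Vec n) (i : Fin n) : ℝ :=
  (x i - ref i) / D.γ k t i

/-- The matrix `4 diag (γ)⁻¹ (1 - diag (e ∘ e))⁻¹` of a later stage. -/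
def Design.ξ {N n : ℕ} (D : Design N n) (k : Fin N) (t : ℝ) (x ref : Vec n) :
    Matrix (Fin n) (Fin n) ℝ :=
  Matrix.diagonal fun i => 4 * (D.γ k t i)⁻¹ * (1 - D.err k t x ref i ^ 2)⁻¹

/-- The output of stage `k` (counted from `0`) at time `t` in the state `x`: the reference signal
for the next state block and, for the last stage, the control input. -/
def Design.stage {N n : ℕ} (D : Design N n) (c : ℝ → Vec n) (r : ℝ → ℝ) (t : ℝ)
    (x : Fin N → Vec n) : (k : ℕ) → k < N → Vec n
  | 0, h => -(D.κ ⟨0, h⟩ * transf (outErr c r t (x ⟨0, h⟩))) • (x ⟨0, h⟩ - c t)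
  | k + 1, h =>
    let ref := D.stage c r t x k (Nat.lt_of_succ_lt h)
    WithLp.toLp 2 (-D.κ ⟨k + 1, h⟩ • (D.ξ ⟨k + 1, h⟩ t (x ⟨k + 1, h⟩) ref).mulVec
      fun i => transf (D.err ⟨k + 1, h⟩ t (x ⟨k + 1, h⟩) ref i))

/-- The control input: the output of the last stage. -/
def Design.control {N n : ℕ} [NeZero N] (D : Design N n) (c : ℝ → Vec n) (r : ℝ → ℝ) (t : ℝ)
    (x : Fin N → Vec n) : Vec n :=
  D.stage c r t x (N - 1) (Nat.sub_one_lt (NeZero.ne N))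

/-- All normalized errors are smaller than `1` in absolute value, that is, the control law is well
defined at time `t` in the state `x`. -/
def Design.Admissible {N n : ℕ} [NeZero N] (D : Design N n) (c : ℝ → Vec n) (r : ℝ → ℝ) (t : ℝ)
    (x : Fin N → Vec n) : Prop :=
  ‖x 0 - c t‖ < r t ∧
    ∀ (k : ℕ) (h : k + 1 < N) (i : Fin n),
      |x ⟨k + 1, h⟩ i - D.stage c r t x k (Nat.lt_of_succ_lt h) i| < D.γ ⟨k + 1, h⟩ t i

/-! ### Closed-loop trajectories -/

/-- What multiplies `g i` in the dynamics: the next state block or, for the last block, the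
input `u`. -/
def next {N n : ℕ} (x : Fin N → Vec n) (u : Vec n) (i : Fin N) : Vec n :=
  if h : (i : ℕ) + 1 < N then x ⟨(i : ℕ) + 1, h⟩ else u

/-- The right-hand side `f_i (z_i) + g_i (z_i) x_{i+1} + w_i` (with `x_{N+1} = u`). -/
def PureFeedbackSystem.rhs {N n : ℕ} (S : PureFeedbackSystem N n) (x : Fin N → Vec n) (u : Vec n)
    (w : Fin N → Vec n) (i : Fin N) : Vec n :=
  S.f i (trunc i x) + WithLp.toLp 2 ((S.g i (trunc i x)).mulVec (next x u i).ofLp) + w i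

/-- `x` is a trajectory of the closed loop on the interval `J` (with left end `0`), started at
`x₀`, under the disturbance `w`: it stays in the state sets and solves the equations in the
Carathéodory (integral) sense. Nothing is required about the errors: where the control law is
undefined its formula is read with the conventions for the logarithm and for division. -/
structure IsClosedLoop {N n : ℕ} [NeZero N] (S : PureFeedbackSystem N n) (D : Design N n)
    (c : ℝ → Vec n) (r : ℝ → ℝ) (w : ℝ → Fin N → Vec n) (x₀ : Fin N → Vec n) (J : Set ℝ)
    (x : ℝ → Fin N → Vec n) : Prop where
  init : x 0 = x₀
  mem : ∀ t ∈ J, ∀ i, x t i ∈ S.X i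
  cont : ContinuousOn x J
  integrable : ∀ t ∈ J, ∀ i,
    IntervalIntegrable (fun s => S.rhs (x s) (D.control c r s (x s)) (w s) i) volume 0 t
  eq : ∀ t ∈ J, ∀ i,
    x t i = x₀ i + ∫ s in (0 : ℝ)..t, S.rhs (x s) (D.control c r s (x s)) (w s) i

end TubeControl

end

/-!
The argument follows the stages of the controller.

Regularity is expressed by `LipschitzNear`: the stages of the control law are Lipschitz near every
time and state at which the control law is well defined, and these times and states form a
relatively open set. If moreover the state sets are not left nearby, the right-hand side of the
closed loop, without the disturbance, is Lipschitz there too.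

The heart of the proof is `IsClosedLoop.exists_tendsto_admissible`. Consider a trajectory on
`[0, τ)` along which the control law is well defined and whose blocks do not leave the state sets in
the limit; then it converges, and the control law is well defined at the limit. This goes by
induction over the stages. Suppose that the reference signal of a stage is Lipschitz on `[0, τ)`.
The state block of that stage is bounded, because its error is, and the next state block differs
from the output of the stage by a bounded error. So the block moves with velocity `g i` applied to
the output of the stage, up to a bounded error, and the output is a nonpositive multiple of the
gradient, with respect to the state block, of a barrier: the squared norm of the normalized error in
the first stage, the sum of the squared transformed errors in a later stage. As the symmetric part
of `g i` is bounded below, the barrier decreases wherever it reaches a suitable threshold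
(`exists_outErr_le`, `Design.exists_abs_transf_le`). Therefore the
normalized errors stay away from `1`, the output of the stage stays bounded, the state block is
Lipschitz and has a limit, and the output of the stage, which is the next reference signal, is
Lipschitz too. Disturbances are only measurable, so the decrease of the barrier is derived from
one-sided bounds for increments (`HasApproxVelocity`, `le_of_barrier`) instead of derivatives.

The first claim follows by looking at the first time at which the control law would not be well
defined (`IsClosedLoop.admissible`). For the second claim, subtracting the integrated disturbance
from the state yields an equation that is continuous in time and locally Lipschitz, and hence has a
maximal solution (`exists_maximal_solution`); if no later block accumulates outside the interior of
its state set, the limit above lies in the domain of the equation, contrary to maximality.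
-/

open scoped NNReal

namespace TubeControl

/-! ### Pointwise local Lipschitz continuity -/

/-- `f` is Lipschitz on some neighbourhood of `x` relative to `s`. In contrast to
`LocallyLipschitzOn`, the point `x` is fixed. -/
def LipschitzNear {α β : Type*} [PseudoEMetricSpace α] [PseudoEMetricSpace β] (f : α → β)
    (s : Set α) (x : α) : Prop :=
  ∃ K : ℝ≥0, ∃ t ∈ 𝓝[s] x, LipschitzOnWith K f t

namespace LipschitzNear

variable {α β δ : Type*} [PseudoEMetricSpace α] [PseudoEMetricSpace β] [PseudoEMetricSpace δ]
  {s : Set α} {x : α}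

theorem continuousWithinAt {f : α → β} (hf : LipschitzNear f s x) (hx : x ∈ s) :
    ContinuousWithinAt f s x := by
  obtain ⟨K, t, ht, h⟩ := hf
  exact (h.continuousOn x (mem_of_mem_nhdsWithin hx ht)).mono_of_mem_nhdsWithin ht

theorem of_lipschitzWith {f : α → β} {K : ℝ≥0} (hf : LipschitzWith K f) : LipschitzNear f s x :=
  ⟨K, univ, univ_mem, hf.lipschitzOnWith⟩

theorem congr {f g : α → β} (hf : LipschitzNear f s x) (h : ∀ᶠ y in 𝓝[s] x, g y = f y) :
    LipschitzNear g s x := by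
  obtain ⟨K, t, ht, hK⟩ := hf
  refine ⟨K, t ∩ {y | g y = f y}, inter_mem ht h, fun a ha b hb => ?_⟩
  rw [ha.2, hb.2]
  exact hK ha.1 hb.1

theorem comp_of_tendsto {f : α → β} {u : Set β} {g : β → δ} (hg : LipschitzNear g u (f x))
    (hf : LipschitzNear f s x) (h : Tendsto f (𝓝[s] x) (𝓝[u] (f x))) :
    LipschitzNear (fun y => g (f y)) s x := by
  obtain ⟨K, t, ht, hK⟩ := hf
  obtain ⟨L, v, hv, hL⟩ := hg
  exact ⟨L * K, t ∩ f ⁻¹' v, inter_mem ht (h hv),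
    hL.comp (hK.mono inter_subset_left) fun y hy => hy.2⟩

theorem comp {f : α → β} {u : Set β} {g : β → δ} (hg : LipschitzNear g u (f x))
    (hf : LipschitzNear f s x) (hx : x ∈ s) (h : ∀ᶠ y in 𝓝[s] x, f y ∈ u) :
    LipschitzNear (fun y => g (f y)) s x :=
  hg.comp_of_tendsto hf (tendsto_nhdsWithin_iff.2 ⟨hf.continuousWithinAt hx, h⟩)

theorem const (a : β) : LipschitzNear (fun _ : α => a) s x :=
  of_lipschitzWith (LipschitzWith.const a)

theorem norm {E : Type*} [NormedAddCommGroup E] {f : α → E}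
    (hf : LipschitzNear f s x) : LipschitzNear (fun y => ‖f y‖) s x := by
  obtain ⟨K, t, ht, hK⟩ := hf
  exact ⟨1 * K, t, ht, lipschitzWith_one_norm.comp_lipschitzOnWith hK⟩

theorem prodMk {f : α → β} {g : α → δ} (hf : LipschitzNear f s x) (hg : LipschitzNear g s x) :
    LipschitzNear (fun y => (f y, g y)) s x := by
  obtain ⟨K, t, ht, hK⟩ := hf
  obtain ⟨L, v, hv, hL⟩ := hg
  exact ⟨max K L, t ∩ v, inter_mem ht hv,
    (hK.mono inter_subset_left).prodMk (hL.mono inter_subset_right)⟩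

theorem pi {ι : Type*} [Fintype ι] {f : α → ι → β} (hf : ∀ i, LipschitzNear (f · i) s x) :
    LipschitzNear f s x := by
  choose K t ht hK using hf
  refine ⟨∑ i, K i, ⋂ i, t i, iInter_mem.2 ht, fun a ha b hb => edist_pi_le_iff.2 fun i => ?_⟩
  refine (hK i (mem_iInter.1 ha i) (mem_iInter.1 hb i)).trans ?_
  gcongr
  exact Finset.single_le_sum (f := K) (fun _ _ => bot_le) (Finset.mem_univ i)

end LipschitzNear

theorem _root_.LocallyLipschitzOn.lipschitzNear {α β : Type*} [PseudoEMetricSpace α]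
    [PseudoEMetricSpace β] {f : α → β} {s : Set α} (hf : LocallyLipschitzOn s f) {x : α}
    (hx : x ∈ s) : LipschitzNear f s x := hf hx

theorem exists_lipschitzOnWith_of_lipschitzNear {α β : Type*} [PseudoMetricSpace α]
    [PseudoMetricSpace β] {f : α → β} {s : Set α} (hs : IsCompact s)
    (hf : ∀ x ∈ s, LipschitzNear f s x) : ∃ K, LipschitzOnWith K f s :=
  LocallyLipschitzOn.exists_lipschitzOnWith_of_compact hs fun x hx => hf x hx

namespace LipschitzNear

variable {α : Type*} [PseudoEMetricSpace α] {s : Set α} {x : α}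
  {E F : Type*} [NormedAddCommGroup E] [NormedSpace ℝ E] [NormedAddCommGroup F] [NormedSpace ℝ F]

theorem contDiffAt_comp {f : α → E} {g : E → F} (hg : ContDiffAt ℝ 1 g (f x))
    (hf : LipschitzNear f s x) (hx : x ∈ s) : LipschitzNear (fun y => g (f y)) s x := by
  obtain ⟨K, t, ht, hK⟩ := hg.exists_lipschitzOnWith
  exact LipschitzNear.comp (u := univ) ⟨K, t, by rwa [nhdsWithin_univ], hK⟩ hf hx (by simp)

theorem add {f g : α → E} (hf : LipschitzNear f s x) (hg : LipschitzNear g s x) (hx : x ∈ s) :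
    LipschitzNear (fun y => f y + g y) s x :=
  contDiffAt_comp (g := fun p : E × E => p.1 + p.2) contDiff_add.contDiffAt (hf.prodMk hg) hx

theorem sub {f g : α → E} (hf : LipschitzNear f s x) (hg : LipschitzNear g s x) (hx : x ∈ s) :
    LipschitzNear (fun y => f y - g y) s x :=
  contDiffAt_comp (g := fun p : E × E => p.1 - p.2) (contDiff_fst.sub contDiff_snd).contDiffAt
    (hf.prodMk hg) hx

theorem smul {f : α → ℝ} {g : α → E} (hf : LipschitzNear f s x) (hg : LipschitzNear g s x)
    (hx : x ∈ s) : LipschitzNear (fun y => f y • g y) s x :=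
  contDiffAt_comp (g := fun p : ℝ × E => p.1 • p.2) contDiff_smul.contDiffAt (hf.prodMk hg) hx

theorem mul {f g : α → ℝ} (hf : LipschitzNear f s x) (hg : LipschitzNear g s x)
    (hx : x ∈ s) : LipschitzNear (fun y => f y * g y) s x := hf.smul hg hx

theorem sum {ι : Type*} {u : Finset ι} {f : ι → α → E} (hf : ∀ i ∈ u, LipschitzNear (f i) s x)
    (hx : x ∈ s) : LipschitzNear (fun y => ∑ i ∈ u, f i y) s x := by
  classical
  induction u using Finset.induction_on with
  | empty => simpa using const 0
  | insert i u hi ih =>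
    simp only [Finset.sum_insert hi]
    exact (hf i (Finset.mem_insert_self i u)).add
      (ih fun j hj => hf j (Finset.mem_insert_of_mem hj)) hx

end LipschitzNear

/-! ### Maximal solutions of ordinary differential equations -/

section ODE

variable {E : Type*} [NormedAddCommGroup E] [NormedSpace ℝ E]

/-- `y` solves `y' = G (t, y)`, `y 0 = y₀` on `[0, b]` with graph in `Ω`. Right derivatives are
used, so that solutions on adjacent intervals can be glued. -/
structure IsSolution (G : ℝ × E → E) (Ω : Set (ℝ × E)) (y₀ : E) (b : ℝ) (y : ℝ → E) : Prop where
  init : y 0 = y₀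
  cont : ContinuousOn y (Icc 0 b)
  mem : ∀ t ∈ Icc 0 b, (t, y t) ∈ Ω
  deriv : ∀ t ∈ Ico 0 b, HasDerivWithinAt y (G (t, y t)) (Ici t) t

theorem continuousOn_Ico_of_forall_Icc {Z : Type*} [TopologicalSpace Z] {y : ℝ → Z} {τ : ℝ}
    (h : ∀ b ∈ Ico 0 τ, ContinuousOn y (Icc 0 b)) : ContinuousOn y (Ico 0 τ) := by
  intro t ht
  obtain ⟨b, hb⟩ := exists_between ht.2
  refine (h b ⟨ht.1.trans hb.1.le, hb.2⟩ t ⟨ht.1, hb.1.le⟩).mono_of_mem_nhdsWithin ?_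
  filter_upwards [self_mem_nhdsWithin, mem_nhdsWithin_of_mem_nhds (Iio_mem_nhds hb.1)]
    with s hs hs' using ⟨hs.1, hs'.le⟩

variable {G : ℝ × E → E} {Ω : Set (ℝ × E)} {y₀ : E} {T b : ℝ} {y z : ℝ → E}

theorem IsSolution.mono (h : IsSolution G Ω y₀ b y) {b' : ℝ} (hb : b' ≤ b) :
    IsSolution G Ω y₀ b' y :=
  ⟨h.init, h.cont.mono (Icc_subset_Icc_right hb), fun t ht => h.mem t ⟨ht.1, ht.2.trans hb⟩,
    fun t ht => h.deriv t ⟨ht.1, ht.2.trans_le hb⟩⟩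

theorem IsSolution.congr (h : IsSolution G Ω y₀ b y) (hb : 0 ≤ b) (hz : EqOn z y (Icc 0 b)) :
    IsSolution G Ω y₀ b z := by
  refine ⟨by rw [hz ⟨le_rfl, hb⟩, h.init], h.cont.congr hz, fun t ht => ?_, fun t ht => ?_⟩
  · rw [hz ht]
    exact h.mem t ht
  · have ht' : t ∈ Icc 0 b := Ico_subset_Icc_self ht
    rw [hz ht']
    refine (h.deriv t ht).congr_of_eventuallyEq ?_ (hz ht')
    filter_upwards [Icc_mem_nhdsGE ht.2] with s hs
    exact hz ⟨ht.1.trans hs.1, hs.2⟩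

/-- Uniqueness: the set of times at which two solutions agree is closed, and it propagates to
the right by the local Lipschitz condition. -/
theorem IsSolution.eqOn (hΩ : Ω ⊆ Icc 0 T ×ˢ univ)
    (hG : ∀ p ∈ Ω, LipschitzNear G (Icc 0 T ×ˢ univ) p)
    (hy : IsSolution G Ω y₀ b y) (hz : IsSolution G Ω y₀ b z) : EqOn y z (Icc 0 b) := by
  have hclosed : IsClosed ({t | y t = z t} ∩ Icc 0 b) := by
    have := (hy.cont.prodMk hz.cont).preimage_isClosed_of_isClosed isClosed_Icc
      (isClosed_diagonal (X := E))
    convert this using 1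
    ext t
    simp [and_comm]
  refine IsClosed.Icc_subset_of_forall_exists_gt hclosed ?_ ?_
  · exact hy.init.trans hz.init.symm
  rintro t ⟨hteq : y t = z t, ht⟩ u hu
  have htI : t ∈ Icc 0 b := Ico_subset_Icc_self ht
  obtain ⟨K, U, hU, hK⟩ := hG _ (hy.mem t htI)
  have hT : ∀ s ∈ Icc 0 b, s ∈ Icc 0 T := fun s hs => (hΩ (hy.mem s hs)).1
  have key : ∀ v : ℝ → E, ContinuousOn v (Icc 0 b) → v t = y t →
      ∀ᶠ s in 𝓝[Icc 0 b] t, (s, v s) ∈ U := by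
    intro v hv hvt
    have : Tendsto (fun s => (s, v s)) (𝓝[Icc 0 b] t) (𝓝[Icc 0 T ×ˢ univ] (t, y t)) := by
      refine tendsto_nhdsWithin_iff.2 ⟨?_, ?_⟩
      · rw [← hvt]
        exact continuousWithinAt_id.prodMk (hv t htI)
      · filter_upwards [self_mem_nhdsWithin] with s hs
        exact ⟨hT s hs, mem_univ _⟩
    exact this hU
  have h2 := (key y hy.cont rfl).and (key z hz.cont hteq.symm)
  obtain ⟨e, he, h3⟩ := Metric.mem_nhdsWithin_iff.1 h2
  set d := min (min b u) (t + e / 2) with hd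
  have htd : t < d := lt_min (lt_min ht.2 hu) (by linarith)
  have hdb : d ≤ b := (min_le_left _ _).trans (min_le_left _ _)
  have hsub : ∀ s ∈ Icc t d, (s, y s) ∈ U ∧ (s, z s) ∈ U := fun s hs => by
    refine h3 ⟨?_, ht.1.trans hs.1, hs.2.trans hdb⟩
    rw [Metric.mem_ball, Real.dist_eq, abs_of_nonneg (by linarith [hs.1])]
    linarith [hs.2.trans (min_le_right (min b u) (t + e / 2))]
  have hI : Icc t d ⊆ Icc 0 b := Icc_subset_Icc ht.1 hdb
  have := ODE_solution_unique_of_mem_Icc_right (v := fun t x => G (t, x))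
    (s := fun t => {x | (t, x) ∈ U}) (K := K) (a := t) (b := d) (f := y) (g := z)
    (fun s _ a ha c hc => by simpa [Prod.edist_eq] using hK ha hc)
    (hy.cont.mono hI) (fun s hs => hy.deriv s ⟨ht.1.trans hs.1, hs.2.trans_le hdb⟩)
    (fun s hs => (hsub s (Ico_subset_Icc_self hs)).1)
    (hz.cont.mono hI) (fun s hs => hz.deriv s ⟨ht.1.trans hs.1, hs.2.trans_le hdb⟩)
    (fun s hs => (hsub s (Ico_subset_Icc_self hs)).2) hteq
  exact ⟨d, this ⟨htd.le, le_rfl⟩, htd, (min_le_left _ _).trans (min_le_right _ _)⟩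

/-- Local existence (Picard–Lindelöf) to the right of a point of `Ω`. -/
theorem exists_local_solution [CompleteSpace E]
    (hopen : ∀ p ∈ Ω, ∀ᶠ p' in 𝓝[Icc 0 T ×ˢ univ] p, p' ∈ Ω)
    (hG : ∀ p ∈ Ω, LipschitzNear G (Icc 0 T ×ˢ univ) p) {t₀ : ℝ} (ht₀ : t₀ ∈ Ico 0 T)
    {a : E} (ha : (t₀, a) ∈ Ω) :
    ∃ t₁ ∈ Ioc t₀ T, ∃ z : ℝ → E, z t₀ = a ∧ ContinuousOn z (Icc t₀ t₁) ∧
      (∀ t ∈ Icc t₀ t₁, (t, z t) ∈ Ω) ∧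
      ∀ t ∈ Ico t₀ t₁, HasDerivWithinAt z (G (t, z t)) (Ici t) t := by
  obtain ⟨K, U, hU, hK⟩ := hG _ ha
  obtain ⟨e, he, hsub⟩ := Metric.mem_nhdsWithin_iff.1 (inter_mem hU (hopen _ ha))
  have hp0 : ((t₀, a) : ℝ × E) ∈ U :=
    (hsub ⟨Metric.mem_ball_self he, ⟨ht₀.1, ht₀.2.le⟩, mem_univ _⟩).1
  set ρ : ℝ := e / 2 with hρ
  have hρ0 : 0 < ρ := by positivity
  -- a bound for `G` on the ball of radius `e`; the time step `h` keeps the solution in radius `ρ`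
  set L : ℝ := ‖G (t₀, a)‖ + K * e with hL
  have hL0 : 0 ≤ L := by positivity
  set h : ℝ := min (min (T - t₀) ρ) (ρ / (L + 1)) with hh
  have hh0 : 0 < h := lt_min (lt_min (by linarith [ht₀.2]) hρ0) (by positivity)
  have hhT : h ≤ T - t₀ := (min_le_left _ _).trans (min_le_left _ _)
  have hhρ : h ≤ ρ := (min_le_left _ _).trans (min_le_right _ _)
  have hhL : L * h ≤ ρ := by
    have h1 : h ≤ ρ / (L + 1) := min_le_right _ _
    calc L * h ≤ (L + 1) * (ρ / (L + 1)) := by gcongr; linarith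
      _ = ρ := by field_simp
  have hmem : ∀ t ∈ Icc t₀ (t₀ + h), ∀ x ∈ Metric.closedBall a ρ, (t, x) ∈ U ∩ Ω := by
    intro t ht x hx
    refine hsub ⟨?_, ⟨ht₀.1.trans ht.1, by linarith [ht.2]⟩, mem_univ _⟩
    rw [Metric.mem_ball, Prod.dist_eq, max_lt_iff]
    constructor
    · rw [Real.dist_eq, abs_of_nonneg (by simpa using ht.1)]
      simp only
      linarith [ht.2]
    · have := Metric.mem_closedBall.1 hx
      simp only
      linarith
  have hpl : IsPicardLindelof (fun t x => G (t, x)) (tmin := t₀) (tmax := t₀ + h)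
      ⟨t₀, le_rfl, by linarith⟩ a ⟨ρ, hρ0.le⟩ 0 ⟨L, hL0⟩ K := by
    refine ⟨fun t ht u hu v hv => ?_, fun x hx => ?_, fun t ht x hx => ?_, ?_⟩
    · simpa [Prod.edist_eq] using hK (hmem t ht u hu).1 (hmem t ht v hv).1
    · exact hK.continuousOn.comp (by fun_prop) fun t ht => (hmem t ht x hx).1
    · have h1 := hK.dist_le_mul _ (hmem t ht x hx).1 _ hp0
      have h2 : dist ((t, x) : ℝ × E) (t₀, a) < e :=
        (Metric.mem_ball.1 (?_ : (t, x) ∈ Metric.ball ((t₀, a) : ℝ × E) e))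
      · rw [dist_eq_norm] at h1
        have h3 : ‖G (t, x)‖ ≤ ‖G (t₀, a)‖ + ‖G (t, x) - G (t₀, a)‖ := by
          simpa using norm_add_le (G (t₀, a)) (G (t, x) - G (t₀, a))
        have h4 : (K : ℝ) * dist ((t, x) : ℝ × E) (t₀, a) ≤ K * e := by gcongr
        change ‖G (t, x)‖ ≤ L
        linarith
      · rw [Metric.mem_ball, Prod.dist_eq, max_lt_iff]
        have := Metric.mem_closedBall.1 hx
        change dist x a ≤ ρ at this
        constructor
        · rw [Real.dist_eq, abs_of_nonneg (by simpa using ht.1)]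
          simp only
          linarith [ht.2]
        · simp only
          linarith
    · have : max (t₀ + h - t₀) (t₀ - t₀) = h := by
        rw [sub_self, add_sub_cancel_left, max_eq_left hh0.le]
      simp only [this]
      simpa using! hhL
  obtain ⟨z, hz0, hz⟩ := hpl.exists_eq_forall_mem_Icc_hasDerivWithinAt₀
  have hzc : ContinuousOn z (Icc t₀ (t₀ + h)) := fun t ht => (hz t ht).continuousWithinAt
  have hnear : ∀ᶠ t in 𝓝[Icc t₀ (t₀ + h)] t₀, z t ∈ Metric.closedBall a ρ := by
    have := hzc t₀ ⟨le_rfl, by linarith⟩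
    refine this (Metric.closedBall_mem_nhds_of_mem ?_)
    simp only at hz0
    rw [hz0]
    exact Metric.mem_ball_self hρ0
  obtain ⟨d, hd, hd'⟩ := Metric.mem_nhdsWithin_iff.1 hnear
  refine ⟨t₀ + min h (d / 2), ⟨by have := lt_min hh0 (half_pos hd); linarith,
    by linarith [min_le_left h (d / 2)]⟩, z, hz0, hzc.mono ?_, fun t ht => ?_, fun t ht => ?_⟩
  · exact Icc_subset_Icc_right (by linarith [min_le_left h (d / 2)])
  · have ht' : t ∈ Icc t₀ (t₀ + h) := ⟨ht.1, by linarith [ht.2, min_le_left h (d / 2)]⟩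
    refine (hmem t ht' _ (hd' ⟨?_, ht'⟩)).2
    rw [Metric.mem_ball, Real.dist_eq, abs_of_nonneg (by linarith [ht.1])]
    linarith [ht.2, min_le_right h (d / 2)]
  · have ht' : t ∈ Ico t₀ (t₀ + h) := ⟨ht.1, by linarith [ht.2, min_le_left h (d / 2)]⟩
    exact (hz t (Ico_subset_Icc_self ht')).mono_of_mem_nhdsWithin
      (mem_of_superset (Icc_mem_nhdsGE ht'.2) (Icc_subset_Icc_left ht'.1))

theorem IsSolution.extend [CompleteSpace E]
    (hopen : ∀ p ∈ Ω, ∀ᶠ p' in 𝓝[Icc 0 T ×ˢ univ] p, p' ∈ Ω)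
    (hG : ∀ p ∈ Ω, LipschitzNear G (Icc 0 T ×ˢ univ) p) (hb : b ∈ Ico 0 T)
    (hy : IsSolution G Ω y₀ b y) : ∃ b' ∈ Ioc b T, ∃ z, IsSolution G Ω y₀ b' z := by
  obtain ⟨b', hb', z, hz0, hzc, hzm, hzd⟩ :=
    exists_local_solution hopen hG hb (hy.mem b ⟨hb.1, le_rfl⟩)
  classical
  set x : ℝ → E := fun t => if t ≤ b then y t else z t with hx
  have hxy : EqOn x y (Iic b) := fun t ht => if_pos ht
  have hxz : EqOn x z (Ici b) := fun t ht => by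
    rcases eq_or_lt_of_le (show b ≤ t from ht) with rfl | h
    · simp [hx, hz0]
    · simp [hx, h.not_ge]
  refine ⟨b', hb', x, by rw [hxy hb.1, hy.init], ?_, fun t ht => ?_, fun t ht => ?_⟩
  · rw [← Icc_union_Icc_eq_Icc hb.1 hb'.1.le]
    exact (hy.cont.congr (hxy.mono Icc_subset_Iic_self)).union_of_isClosed
      (hzc.congr (hxz.mono Icc_subset_Ici_self)) isClosed_Icc isClosed_Icc
  · rcases le_total t b with h | h
    · rw [hxy h]
      exact hy.mem t ⟨ht.1, h⟩
    · rw [hxz h]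
      exact hzm t ⟨h, ht.2⟩
  · rcases lt_or_ge t b with h | h
    · rw [hxy h.le]
      refine (hy.deriv t ⟨ht.1, h⟩).congr_of_eventuallyEq ?_ (hxy h.le)
      filter_upwards [Icc_mem_nhdsGE h] with s hs using hxy hs.2
    · rw [hxz h]
      refine (hzd t ⟨h, ht.2⟩).congr_of_eventuallyEq ?_ (hxz h)
      filter_upwards [self_mem_nhdsWithin] with s hs using hxz (h.trans hs)

/-- A locally Lipschitz differential equation on a relatively open set `Ω` has a solution up to
time `T`, or one on an interval `[0, τ)` that does not converge to a point of `Ω` at time `τ`. -/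
theorem exists_maximal_solution [CompleteSpace E] (hT : 0 ≤ T) (hΩ : Ω ⊆ Icc 0 T ×ˢ univ)
    (hopen : ∀ p ∈ Ω, ∀ᶠ p' in 𝓝[Icc 0 T ×ˢ univ] p, p' ∈ Ω)
    (hG : ∀ p ∈ Ω, LipschitzNear G (Icc 0 T ×ˢ univ) p) (h0 : ((0 : ℝ), y₀) ∈ Ω) :
    (∃ y, IsSolution G Ω y₀ T y) ∨
      ∃ τ ∈ Ioc 0 T, ∃ y, (∀ b ∈ Ico 0 τ, IsSolution G Ω y₀ b y) ∧
        ∀ z, Tendsto y (𝓝[<] τ) (𝓝 z) → (τ, z) ∉ Ω := by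
  set A : Set ℝ := {b | b ∈ Icc 0 T ∧ ∃ y, IsSolution G Ω y₀ b y} with hA
  have h0A : (0 : ℝ) ∈ A := by
    refine ⟨⟨le_rfl, hT⟩, fun _ => y₀, rfl, continuousOn_const, fun t ht => ?_, fun t ht => ?_⟩
    · rwa [le_antisymm ht.2 ht.1]
    · exact absurd ht.2 (not_lt.2 ht.1)
  have hbdd : BddAbove A := ⟨T, fun b hb => hb.1.2⟩
  set τ := sSup A with hτ
  have hτT : τ ≤ T := csSup_le ⟨0, h0A⟩ fun b hb => hb.1.2
  by_cases hτA : τ ∈ A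
  · left
    rcases hτT.eq_or_lt with h | h
    · exact h ▸ hτA.2
    · obtain ⟨y, hy⟩ := hτA.2
      obtain ⟨b', hb', z, hz⟩ := hy.extend hopen hG ⟨hτA.1.1, h⟩
      have : b' ≤ τ := le_csSup hbdd ⟨⟨hτA.1.1.trans hb'.1.le, hb'.2⟩, z, hz⟩
      exact absurd this (not_le.2 hb'.1)
  · right
    have hτ0 : 0 < τ := lt_of_le_of_ne (le_csSup hbdd h0A) fun h => hτA (h ▸ h0A)
    have hex : ∀ b ∈ Ico 0 τ, ∃ y, IsSolution G Ω y₀ b y := by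
      intro b hb
      obtain ⟨b', hb'A, hb'⟩ := exists_lt_of_lt_csSup ⟨0, h0A⟩ hb.2
      obtain ⟨y, hy⟩ := hb'A.2
      exact ⟨y, hy.mono hb'.le⟩
    choose! Y hY using hex
    -- by uniqueness, the values `Y t t` of solutions on `[0, t]` form a single solution on `[0, τ)`
    have hsol : ∀ b ∈ Ico 0 τ, IsSolution G Ω y₀ b fun t => Y t t := fun b hb =>
      (hY b hb).congr hb.1 fun t ht =>
        ((hY t ⟨ht.1, ht.2.trans_lt hb.2⟩).eqOn hΩ hG ((hY b hb).mono ht.2)) ⟨ht.1, le_rfl⟩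
    refine ⟨τ, ⟨hτ0, hτT⟩, fun t => Y t t, hsol, fun z hz hzΩ => hτA ⟨⟨hτ0.le, hτT⟩, ?_⟩⟩
    refine ⟨Function.update (fun t => Y t t) τ z, ?_, ?_, ?_, ?_⟩
    · rw [Function.update_of_ne hτ0.ne]
      exact (hsol 0 ⟨le_rfl, hτ0⟩).init
    · rw [continuousOn_update_iff]
      have hdiff : Icc 0 τ \ {τ} = Ico 0 τ := Icc_sdiff_right
      rw [hdiff]
      exact ⟨continuousOn_Ico_of_forall_Icc fun b hb => (hsol b hb).cont,
        fun _ => hz.mono_left (nhdsWithin_mono _ Ico_subset_Iio_self)⟩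
    · intro t ht
      rcases ht.2.eq_or_lt with rfl | h
      · simpa using hzΩ
      · rw [Function.update_of_ne h.ne]
        exact (hsol t ⟨ht.1, h⟩).mem t ⟨ht.1, le_rfl⟩
    · intro t ht
      rw [Function.update_of_ne ht.2.ne]
      obtain ⟨b, hb⟩ := exists_between ht.2
      refine ((hsol b ⟨ht.1.trans hb.1.le, hb.2⟩).deriv t ⟨ht.1, hb.1⟩).congr_of_eventuallyEq ?_
        (Function.update_of_ne ht.2.ne _ _)
      filter_upwards [mem_nhdsWithin_of_mem_nhds (Iio_mem_nhds ht.2)] with s hs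
      exact Function.update_of_ne (ne_of_lt hs) _ _

end ODE

/-! ### Regularity of the controller -/

section Controller

variable {N n : ℕ}

theorem Design.γ_pos (D : Design N n) (k : Fin N) (t : ℝ) (i : Fin n) : 0 < D.γ k t i :=
  add_pos (mul_pos (sub_pos.2 (D.q_lt_p k i)) (Real.exp_pos _)) (D.q_pos k i)

theorem Design.γ_le (D : Design N n) (k : Fin N) {t : ℝ} (ht : 0 ≤ t) (i : Fin n) :
    D.γ k t i ≤ D.p k i := by
  have h1 : Real.exp (-D.μ k i * t) ≤ 1 := Real.exp_le_one_iff.2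
    (mul_nonpos_of_nonpos_of_nonneg (neg_nonpos.2 (D.μ_nonneg k i)) ht)
  have h2 := mul_le_of_le_one_right (sub_pos.2 (D.q_lt_p k i)).le h1
  rw [Design.γ]
  linarith

theorem Design.le_γ (D : Design N n) (k : Fin N) (t : ℝ) (i : Fin n) :
    D.q k i ≤ D.γ k t i :=
  le_add_of_nonneg_left (mul_pos (sub_pos.2 (D.q_lt_p k i)) (Real.exp_pos _)).le

theorem Design.γ_zero (D : Design N n) (k : Fin N) (i : Fin n) : D.γ k 0 i = D.p k i := by
  simp [Design.γ]

theorem Design.contDiff_γ (D : Design N n) (k : Fin N) (i : Fin n) :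
    ContDiff ℝ 1 fun t => D.γ k t i := by
  unfold Design.γ
  fun_prop

theorem contDiffAt_transf {e : ℝ} (he : |e| < 1) : ContDiffAt ℝ 1 transf e := by
  obtain ⟨h1, h2⟩ := abs_lt.1 he
  have h3 : 1 - e ≠ 0 := by linarith
  have h4 : (1 + e) / (1 - e) ≠ 0 := div_ne_zero (by linarith) h3
  unfold transf
  fun_prop (disch := assumption)

theorem Design.abs_err_lt_one (D : Design N n) {k : Fin N} {t : ℝ} {x ref : Vec n} {i : Fin n}
    (h : |x i - ref i| < D.γ k t i) : |D.err k t x ref i| < 1 := by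
  rwa [Design.err, abs_div, abs_of_pos (D.γ_pos k t i), div_lt_one (D.γ_pos k t i)]

/-- The output of a stage after the first one, as a function of the time, of the state block of
that stage and of its reference signal. -/
noncomputable def Design.laterStage (D : Design N n) (k : Fin N) (t : ℝ) (x ref : Vec n) : Vec n :=
  WithLp.toLp 2 (-D.κ k • (D.ξ k t x ref).mulVec fun i => transf (D.err k t x ref i))

theorem Design.stage_succ (D : Design N n) (c : ℝ → Vec n) (r : ℝ → ℝ) (t : ℝ)
    (x : Fin N → Vec n) (k : ℕ) (h : k + 1 < N) :
    D.stage c r t x (k + 1) h =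
      D.laterStage ⟨k + 1, h⟩ t (x ⟨k + 1, h⟩) (D.stage c r t x k (Nat.lt_of_succ_lt h)) := rfl

theorem Design.laterStage_apply (D : Design N n) (k : Fin N) (t : ℝ) (x ref : Vec n)
    (i : Fin n) :
    D.laterStage k t x ref i =
      -D.κ k * (4 * (D.γ k t i)⁻¹ * (1 - D.err k t x ref i ^ 2)⁻¹ *
        transf (D.err k t x ref i)) := by
  simp [Design.laterStage, Design.ξ, Matrix.mulVec_diagonal]

variable {P : Type*} [PseudoEMetricSpace P] {s : Set P} {p : P}

theorem LipschitzNear.apply {x : P → Vec n} (hx : LipschitzNear x s p) (hp : p ∈ s) (i : Fin n) :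
    LipschitzNear (fun y => x y i) s p :=
  LipschitzNear.contDiffAt_comp (g := fun v : Vec n => v i)
    (EuclideanSpace.proj (𝕜 := ℝ) i).contDiff.contDiffAt hx hp

theorem LipschitzNear.toLp {x : P → Fin n → ℝ} (hx : ∀ i, LipschitzNear (x · i) s p)
    (hp : p ∈ s) : LipschitzNear (fun y => (WithLp.toLp 2 (x y) : Vec n)) s p :=
  LipschitzNear.contDiffAt_comp (g := fun v : Fin n → ℝ => (WithLp.toLp 2 v : Vec n))
    (PiLp.contDiff_toLp).contDiffAt (LipschitzNear.pi hx) hp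

theorem LipschitzNear.mulVec {A : P → Matrix (Fin n) (Fin n) ℝ} {x : P → Vec n}
    (hA : ∀ a b, LipschitzNear (fun y => A y a b) s p) (hx : LipschitzNear x s p) (hp : p ∈ s) :
    LipschitzNear (fun y => (WithLp.toLp 2 ((A y).mulVec (x y).ofLp) : Vec n)) s p :=
  LipschitzNear.toLp (fun a => LipschitzNear.sum (u := Finset.univ)
    (f := fun b y => A y a b * x y b) (fun b _ => (hA a b).mul (hx.apply hp b) hp) hp) hp

theorem LipschitzNear.comp_contDiffOn {F : Type*} [NormedAddCommGroup F] [NormedSpace ℝ F]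
    {c : ℝ → F} (hc : ContDiffOn ℝ 1 c (Ici 0)) {t : P → ℝ} (ht : LipschitzNear t s p)
    (ht0 : MapsTo t s (Ici 0)) (hp : p ∈ s) : LipschitzNear (fun y => c (t y)) s p := by
  obtain ⟨K, u, hu, hK⟩ := (hc _ (ht0 hp)).exists_lipschitzOnWith (convex_Ici 0)
  exact LipschitzNear.comp ⟨K, u, hu, hK⟩ ht hp (eventually_mem_nhdsWithin.mono ht0)

theorem Design.lipschitzNear_laterStage (D : Design N n) (k : Fin N) {t : P → ℝ}
    {x ref : P → Vec n} (hp : p ∈ s) (ht : LipschitzNear t s p) (hx : LipschitzNear x s p)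
    (href : LipschitzNear ref s p) (h : ∀ i, |x p i - ref p i| < D.γ k (t p) i) :
    LipschitzNear (fun y => D.laterStage k (t y) (x y) (ref y)) s p := by
  refine LipschitzNear.toLp (fun i => ?_) hp
  have he := D.abs_err_lt_one (h i)
  have hγ : LipschitzNear (fun y => (D.γ k (t y) i)⁻¹) s p :=
    LipschitzNear.contDiffAt_comp (g := fun t => (D.γ k t i)⁻¹)
      ((D.contDiff_γ k i).contDiffAt.inv (D.γ_pos k _ i).ne') ht hp
  have herr : LipschitzNear (fun y => D.err k (t y) (x y) (ref y) i) s p := by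
    simp only [Design.err, div_eq_mul_inv]
    exact ((hx.apply hp i).sub (href.apply hp i) hp).mul hγ hp
  have htr : LipschitzNear (fun y => transf (D.err k (t y) (x y) (ref y) i)) s p :=
    LipschitzNear.contDiffAt_comp (contDiffAt_transf he) herr hp
  have hsq : LipschitzNear (fun y => (1 - D.err k (t y) (x y) (ref y) i ^ 2)⁻¹) s p := by
    refine LipschitzNear.contDiffAt_comp (g := fun e : ℝ => (1 - e ^ 2)⁻¹) ?_ herr hp
    have : 1 - D.err k (t p) (x p) (ref p) i ^ 2 ≠ 0 := by
      have := (sq_lt_one_iff_abs_lt_one _).2 he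
      linarith
    fun_prop (disch := assumption)
  have := (LipschitzNear.const (-D.κ k)).mul
    ((((LipschitzNear.const (4 : ℝ)).mul hγ hp).mul hsq hp).mul htr hp) hp
  refine this.congr (Eventually.of_forall fun y => ?_)
  simp [Design.ξ, Matrix.mulVec_diagonal]

variable {c : ℝ → Vec n} {r : ℝ → ℝ}

theorem lipschitzNear_firstStage (κ : ℝ) (hc : ContDiffOn ℝ 1 c (Ici 0))
    (hr : ContDiffOn ℝ 1 r (Ici 0)) {t : P → ℝ} {x : P → Vec n} (hp : p ∈ s)
    (ht : LipschitzNear t s p) (ht0 : MapsTo t s (Ici 0)) (hx : LipschitzNear x s p)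
    (h : ‖x p - c (t p)‖ < r (t p)) :
    LipschitzNear (fun y => -(κ * transf (outErr c r (t y) (x y))) • (x y - c (t y))) s p := by
  have hd := hx.sub (LipschitzNear.comp_contDiffOn hc ht ht0 hp) hp
  have hr0 : 0 < r (t p) := (norm_nonneg _).trans_lt h
  have hrinv : LipschitzNear (fun y => (r (t y))⁻¹) s p :=
    LipschitzNear.contDiffAt_comp (g := fun a : ℝ => a⁻¹) (contDiffAt_inv ℝ hr0.ne')
      (LipschitzNear.comp_contDiffOn hr ht ht0 hp) hp
  have he : LipschitzNear (fun y => outErr c r (t y) (x y)) s p := by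
    simp only [outErr, div_eq_mul_inv]
    exact hd.norm.mul hrinv hp
  have he1 : |outErr c r (t p) (x p)| < 1 := by
    rwa [outErr, abs_div, abs_norm, abs_of_pos hr0, div_lt_one hr0]
  have htr : LipschitzNear (fun y => transf (outErr c r (t y) (x y))) s p :=
    LipschitzNear.contDiffAt_comp (contDiffAt_transf he1) he hp
  refine (((LipschitzNear.const (-κ)).mul htr hp).smul hd hp).congr
    (Eventually.of_forall fun y => ?_)
  simp

variable [NeZero N]

theorem fin_mk_zero (h : 0 < N) : (⟨0, h⟩ : Fin N) = 0 := Fin.ext (by simp)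

/-- The normalized errors of the stages `0, …, k` are smaller than `1` in absolute value. -/
def Design.AdmissibleUpTo (D : Design N n) (c : ℝ → Vec n) (r : ℝ → ℝ) (t : ℝ)
    (x : Fin N → Vec n) (k : ℕ) : Prop :=
  ‖x 0 - c t‖ < r t ∧
    ∀ (j : ℕ) (h : j + 1 < N) (i : Fin n), j + 1 ≤ k →
      |x ⟨j + 1, h⟩ i - D.stage c r t x j (Nat.lt_of_succ_lt h) i| < D.γ ⟨j + 1, h⟩ t i

theorem Design.AdmissibleUpTo.mono {D : Design N n} {t : ℝ} {x : Fin N → Vec n} {k l : ℕ}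
    (h : D.AdmissibleUpTo c r t x k) (hl : l ≤ k) : D.AdmissibleUpTo c r t x l :=
  ⟨h.1, fun j hj i hjl => h.2 j hj i (hjl.trans hl)⟩

theorem Design.Admissible.upTo {D : Design N n} {t : ℝ} {x : Fin N → Vec n}
    (h : D.Admissible c r t x) (k : ℕ) : D.AdmissibleUpTo c r t x k :=
  ⟨h.1, fun j hj i _ => h.2 j hj i⟩

theorem Design.AdmissibleUpTo.admissible {D : Design N n} {t : ℝ} {x : Fin N → Vec n} {k : ℕ}
    (h : D.AdmissibleUpTo c r t x k) (hk : N ≤ k + 1) : D.Admissible c r t x :=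
  ⟨h.1, fun j hj i => h.2 j hj i (by omega)⟩

theorem Design.lipschitzNear_stage (D : Design N n) (hc : ContDiffOn ℝ 1 c (Ici 0))
    (hr : ContDiffOn ℝ 1 r (Ici 0)) {t : P → ℝ} {x : P → Fin N → Vec n} (hp : p ∈ s)
    (ht : LipschitzNear t s p) (ht0 : MapsTo t s (Ici 0)) (k : ℕ) (hk : k < N)
    (hx : ∀ j : Fin N, (j : ℕ) ≤ k → LipschitzNear (x · j) s p)
    (h : D.AdmissibleUpTo c r (t p) (x p) k) :
    LipschitzNear (fun y => D.stage c r (t y) (x y) k hk) s p := by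
  induction k with
  | zero =>
    refine lipschitzNear_firstStage _ hc hr hp ht ht0 (hx _ le_rfl) ?_
    rw [fin_mk_zero]
    exact h.1
  | succ k ih =>
    simp only [Design.stage_succ]
    exact D.lipschitzNear_laterStage _ hp ht (hx _ le_rfl)
      (ih _ (fun j hj => hx j (hj.trans k.le_succ)) (h.mono k.le_succ))
      fun i => h.2 k hk i le_rfl

/-- The set of times and states where the control law is well defined is relatively open. -/
theorem Design.eventually_admissible (D : Design N n) (hc : ContDiffOn ℝ 1 c (Ici 0))
    (hr : ContDiffOn ℝ 1 r (Ici 0)) {t : P → ℝ} {x : P → Fin N → Vec n} (hp : p ∈ s)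
    (ht : LipschitzNear t s p) (ht0 : MapsTo t s (Ici 0))
    (hx : ∀ j, LipschitzNear (x · j) s p) (h : D.Admissible c r (t p) (x p)) :
    ∀ᶠ y in 𝓝[s] p, D.Admissible c r (t y) (x y) := by
  refine Eventually.and ?_ ?_
  · exact Tendsto.eventually_lt
      (((hx 0).sub (LipschitzNear.comp_contDiffOn hc ht ht0 hp) hp).norm.continuousWithinAt hp)
      ((LipschitzNear.comp_contDiffOn hr ht ht0 hp).continuousWithinAt hp) h.1
  · have key : ∀ k : Fin N, ∀ᶠ y in 𝓝[s] p, ∀ (h : (k : ℕ) + 1 < N) (i : Fin n),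
        |x y ⟨k + 1, h⟩ i - D.stage c r (t y) (x y) k (Nat.lt_of_succ_lt h) i| <
          D.γ ⟨k + 1, h⟩ (t y) i := by
      intro k
      by_cases hk : (k : ℕ) + 1 < N
      · have : ∀ᶠ y in 𝓝[s] p, ∀ i : Fin n,
            |x y ⟨k + 1, hk⟩ i - D.stage c r (t y) (x y) k (Nat.lt_of_succ_lt hk) i| <
              D.γ ⟨k + 1, hk⟩ (t y) i := by
          refine eventually_all.2 fun i => ?_
          refine Tendsto.eventually_lt (ContinuousWithinAt.abs ?_) ?_ (h.2 k hk i)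
          · exact (((hx _).apply hp i).sub ((D.lipschitzNear_stage hc hr hp ht ht0 k _
              (fun j _ => hx j) (h.upTo k)).apply hp i) hp).continuousWithinAt hp
          · exact (LipschitzNear.contDiffAt_comp (D.contDiff_γ _ i).contDiffAt ht
              hp).continuousWithinAt hp
        exact this.mono fun y hy _ => hy
      · exact Eventually.of_forall fun y h => absurd h hk
    filter_upwards [eventually_all.2 key] with y hy k hk i
    exact hy ⟨k, by omega⟩ hk i

end Controller

/-! ### Regularity of the right-hand side -/

section System

theorem PureFeedbackSystem.trunc_mem_dom {N n : ℕ} (S : PureFeedbackSystem N n) {i : Fin N}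
    {x : Fin N → Vec n} (hx : ∀ j, x j ∈ S.X j) : trunc i x ∈ S.dom i := fun _ => hx _

variable {N n : ℕ} [NeZero N] {S : PureFeedbackSystem N n} {P : Type*} [PseudoEMetricSpace P]
  {s : Set P} {p : P} {c : ℝ → Vec n} {r : ℝ → ℝ}

/-- The right-hand side without the disturbance is Lipschitz near each point where the control law
is well defined, if the state sets are not left nearby. -/
theorem Design.lipschitzNear_rhs (D : Design N n) (hlip : S.LocLipschitz)
    (hc : ContDiffOn ℝ 1 c (Ici 0))
    (hr : ContDiffOn ℝ 1 r (Ici 0)) {t : P → ℝ} {x : P → Fin N → Vec n} (hp : p ∈ s)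
    (ht : LipschitzNear t s p) (ht0 : MapsTo t s (Ici 0))
    (hx : ∀ j, LipschitzNear (x · j) s p) (h : D.Admissible c r (t p) (x p))
    (hX : ∀ᶠ y in 𝓝[s] p, ∀ j, x y j ∈ S.X j) (i : Fin N) :
    LipschitzNear (fun y => S.rhs (x y) (D.control c r (t y) (x y)) 0 i) s p := by
  have htr : LipschitzNear (fun y => trunc i (x y)) s p := LipschitzNear.pi fun j => hx _
  have hdom : ∀ᶠ y in 𝓝[s] p, trunc i (x y) ∈ S.dom i :=
    hX.mono fun y hy => S.trunc_mem_dom hy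
  have hdomp := hdom.self_of_nhdsWithin hp
  have hf : LipschitzNear (fun y => S.f i (trunc i (x y))) s p :=
    LipschitzNear.comp ((hlip i).1.lipschitzNear hdomp) htr hp hdom
  have hg : ∀ a b, LipschitzNear (fun y => S.g i (trunc i (x y)) a b) s p := fun a b =>
    LipschitzNear.comp (g := fun z => S.g i z a b)
      (((hlip i).2 a b).lipschitzNear hdomp) htr hp hdom
  have hn : LipschitzNear (fun y => next (x y) (D.control c r (t y) (x y)) i) s p := by
    unfold next
    split_ifs with hi
    · exact hx _
    · exact D.lipschitzNear_stage hc hr hp ht ht0 _ _ (fun j _ => hx j) (h.upTo _)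
  exact (hf.add (LipschitzNear.mulVec hg hn hp) hp).add (LipschitzNear.const 0) hp

end System

/-! ### Coercivity of the input matrices -/

section Matrices

variable {n : ℕ}

/-- The matrix `A` applied to a vector of `ℝⁿ`. -/
noncomputable def act (A : Matrix (Fin n) (Fin n) ℝ) (v : Vec n) : Vec n :=
  WithLp.toLp 2 (A.mulVec v.ofLp)

theorem act_sub (A : Matrix (Fin n) (Fin n) ℝ) (v w : Vec n) :
    act A (v - w) = act A v - act A w := by
  simp [act, Matrix.mulVec_sub]

theorem act_smul (A : Matrix (Fin n) (Fin n) ℝ) (a : ℝ) (v : Vec n) :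
    act A (a • v) = a • act A v := by
  simp [act, Matrix.mulVec_smul]

theorem norm_le_sum_abs (v : Vec n) : ‖v‖ ≤ ∑ i, |v i| := by
  rw [EuclideanSpace.norm_eq]
  refine Real.sqrt_le_iff.2 ⟨by positivity, ?_⟩
  simp only [Real.norm_eq_abs]
  exact Finset.sum_sq_le_sq_sum_of_nonneg fun i _ => abs_nonneg _

theorem norm_act_le (A : Matrix (Fin n) (Fin n) ℝ) (v : Vec n) :
    ‖act A v‖ ≤ (∑ a, ∑ b, |A a b|) * ‖v‖ := by
  refine (norm_le_sum_abs _).trans ?_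
  rw [Finset.sum_mul]
  refine Finset.sum_le_sum fun a _ => ?_
  rw [Finset.sum_mul]
  change |∑ b, A a b * v b| ≤ _
  refine (Finset.abs_sum_le_sum_abs (fun b => A a b * v b) _).trans
    (Finset.sum_le_sum fun b _ => ?_)
  rw [abs_mul]
  gcongr
  simpa using PiLp.norm_apply_le v b

theorem norm_le_mul_norm {v w : Vec n} {C : ℝ} (hC : 0 ≤ C) (h : ∀ i, |v i| ≤ C * |w i|) :
    ‖v‖ ≤ C * ‖w‖ := by
  rw [EuclideanSpace.norm_eq, EuclideanSpace.norm_eq]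
  refine Real.sqrt_le_iff.2 ⟨by positivity, ?_⟩
  rw [mul_pow, Real.sq_sqrt (by positivity), Finset.mul_sum]
  refine Finset.sum_le_sum fun i _ => ?_
  rw [← mul_pow]
  exact pow_le_pow_left₀ (norm_nonneg _) (h i) 2

theorem inner_act_symmPart (A : Matrix (Fin n) (Fin n) ℝ) (v : Vec n) :
    inner ℝ v (act (symmPart A) v) = inner ℝ v (act A v) := by
  have h : ∀ B : Matrix (Fin n) (Fin n) ℝ, inner ℝ v (act B v) = v.ofLp ⬝ᵥ B.mulVec v.ofLp := by
    intro B
    rw [act, PiLp.inner_apply]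
    simp [dotProduct, mul_comm]
  rw [h, h, symmPart, Matrix.smul_mulVec, Matrix.add_mulVec, dotProduct_smul, dotProduct_add,
    Matrix.mulVec_transpose, dotProduct_comm v.ofLp (Matrix.vecMul _ _), ← Matrix.dotProduct_mulVec,
    smul_eq_mul]
  ring

/-- Expansion in an orthonormal basis of eigenvectors of the symmetric part. -/
theorem mul_norm_sq_le_inner_act {A : Matrix (Fin n) (Fin n) ℝ} {b : ℝ}
    (h : ∀ j, b ≤ (isHermitian_symmPart A).eigenvalues j) (v : Vec n) :
    b * ‖v‖ ^ 2 ≤ inner ℝ v (act A v) := by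
  rw [← inner_act_symmPart]
  set H := isHermitian_symmPart A
  set e := H.eigenvectorBasis
  have hact : act (symmPart A) v = ∑ j, (e.repr v j * H.eigenvalues j) • e j := by
    conv_lhs => rw [← e.sum_repr v]
    have hlin : ∀ w, act (symmPart A) w = (symmPart A).toEuclideanLin w := fun w => rfl
    rw [hlin, map_sum]
    refine Finset.sum_congr rfl fun j _ => ?_
    rw [map_smul, mul_smul, ← hlin]
    congr 1
    have := H.mulVec_eigenvectorBasis j
    rw [act, this]
    rfl
  rw [hact, inner_sum]
  have hn : ‖v‖ ^ 2 = ∑ j, e.repr v j ^ 2 := by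
    rw [← e.repr.norm_map v, EuclideanSpace.norm_sq_eq]
    simp
  rw [hn, Finset.mul_sum]
  refine Finset.sum_le_sum fun j _ => ?_
  rw [inner_smul_right, real_inner_comm, ← e.repr_apply_apply]
  nlinarith [h j, sq_nonneg (e.repr v j)]

end Matrices

/-! ### Curves on half-open intervals -/

section Curves

/-- A continuous function is bounded along a bounded curve on `[0, τ)` whose cluster points at `τ`
lie in the domain of continuity: the closure of the curve is then a compact part of the domain. -/
theorem exists_le_of_cluster_mem {Z : Type*} [NormedAddCommGroup Z] [ProperSpace Z] {u : ℝ → Z}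
    {τ C : ℝ} {D : Set Z} {φ : Z → ℝ} (hu : ContinuousOn u (Ico 0 τ))
    (hC : ∀ t ∈ Ico 0 τ, ‖u t‖ ≤ C) (hD : ∀ t ∈ Ico 0 τ, u t ∈ D)
    (hcl : ∀ z, MapClusterPt z (𝓝[<] τ) u → z ∈ D) (hφ : ContinuousOn φ D) :
    ∃ B, ∀ t ∈ Ico 0 τ, φ (u t) ≤ B := by
  have hcomp : IsCompact (closure (u '' Ico 0 τ)) := by
    refine ((isBounded_iff_forall_norm_le).2 ⟨C, ?_⟩).isCompact_closure
    rintro _ ⟨t, ht, rfl⟩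
    exact hC t ht
  have hsub : closure (u '' Ico 0 τ) ⊆ D := by
    intro z hz
    have hz' : MapClusterPt z (𝓟 (Ico 0 τ)) u := by
      rw [MapClusterPt, map_principal]
      exact mem_closure_iff_clusterPt.1 hz
    obtain ⟨U, hU, hUz⟩ := mapClusterPt_iff_ultrafilter.1 hz'
    have hUI : Ico 0 τ ∈ U := le_principal_iff.1 hU
    obtain ⟨t, ht, hUt⟩ := isCompact_iff_ultrafilter_le_nhds.1 (isCompact_Icc (a := 0) (b := τ)) U
      (le_principal_iff.2 (mem_of_superset hUI Ico_subset_Icc_self))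
    rcases ht.2.eq_or_lt with rfl | htτ
    · refine hcl z (mapClusterPt_iff_ultrafilter.2 ⟨U, le_inf hUt ?_, hUz⟩)
      exact le_principal_iff.2 (mem_of_superset hUI Ico_subset_Iio_self)
    · have h1 : Tendsto u U (𝓝 (u t)) :=
        (hu t ⟨ht.1, htτ⟩).mono_left (le_inf hUt hU)
      rw [tendsto_nhds_unique hUz h1]
      exact hD t ⟨ht.1, htτ⟩
  obtain ⟨B, hB⟩ := (hcomp.image_of_continuousOn (hφ.mono hsub)).bddAbove
  exact ⟨B, fun t ht => hB ⟨_, subset_closure ⟨t, ht, rfl⟩, rfl⟩⟩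

/-- Extension of a Lipschitz curve on `[0, τ)` by its limit at `τ`. -/
theorem exists_lipschitzOnWith_Icc_of_Ico {n : ℕ} {v v' : ℝ → Vec n} {τ : ℝ} {K : ℝ≥0}
    (hτ : 0 < τ) (hv : LipschitzOnWith K v (Ico 0 τ)) (h : EqOn v' v (Ico 0 τ))
    (hlim : v' τ = limUnder (𝓝[<] τ) v) :
    ∃ K', LipschitzOnWith K' v' (Icc 0 τ) := by
  obtain ⟨V, hV, hVv⟩ := hv.extend_finite_dimension
  have hIco : Ico 0 τ ∈ 𝓝[<] τ := Ico_mem_nhdsLT hτ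
  have h1 : Tendsto v (𝓝[<] τ) (𝓝 (V τ)) := by
    refine (hV.continuous.continuousAt.mono_left nhdsWithin_le_nhds).congr' ?_
    filter_upwards [hIco] with t ht using (hVv ht).symm
  have h2 : EqOn v' V (Icc 0 τ) := by
    intro t ht
    rcases ht.2.eq_or_lt with rfl | htτ
    · rw [hlim, h1.limUnder_eq]
    · rw [h ⟨ht.1, htτ⟩, hVv ⟨ht.1, htτ⟩]
  refine ⟨lipschitzExtensionConstant (Vec n) * K, fun a ha b hb => ?_⟩
  rw [h2 ha, h2 hb]
  exact hV a b

/-- To the right of `t`, the curve `e` moves with velocity `η` up to an error of size `Λ`. This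
replaces differentiability, which measurable disturbances rule out. -/
def HasApproxVelocity {V : Type*} [NormedAddCommGroup V] [NormedSpace ℝ V] (e : ℝ → V) (η : V)
    (Λ t : ℝ) : Prop :=
  ∀ ε > 0, ∀ᶠ s in 𝓝[>] t, ‖e s - e t - (s - t) • η‖ ≤ (Λ + ε) * (s - t)

theorem _root_.LipschitzOnWith.eventually_norm_sub_le {V : Type*} [NormedAddCommGroup V]
    {R : ℝ → V} {τ t : ℝ} {L : ℝ≥0} (hR : LipschitzOnWith L R (Ico 0 τ)) (ht : t ∈ Ico 0 τ) :
    ∀ᶠ s in 𝓝[>] t, ‖R s - R t‖ ≤ L * (s - t) := by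
  filter_upwards [Ioo_mem_nhdsGT ht.2] with s hs
  have := hR.norm_sub_le ⟨ht.1.trans hs.1.le, hs.2⟩ ht
  rwa [Real.norm_of_nonneg (sub_pos.2 hs.1).le] at this

theorem HasApproxVelocity.sub_lipschitz {V : Type*} [NormedAddCommGroup V] [NormedSpace ℝ V]
    {x R : ℝ → V} {η : V} {Λ τ t : ℝ} {L : ℝ≥0} (h : HasApproxVelocity x η Λ t)
    (hR : LipschitzOnWith L R (Ico 0 τ)) (ht : t ∈ Ico 0 τ) :
    HasApproxVelocity (fun s => x s - R s) η (Λ + L) t := by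
  intro ε hε
  filter_upwards [h ε hε, hR.eventually_norm_sub_le ht] with s hs hRs
  calc ‖x s - R s - (x t - R t) - (s - t) • η‖
      = ‖(x s - x t - (s - t) • η) - (R s - R t)‖ := by congr 1; abel
    _ ≤ (Λ + ε) * (s - t) + L * (s - t) := (norm_sub_le _ _).trans (add_le_add hs hRs)
    _ = (Λ + L + ε) * (s - t) := by ring

/-- Scaling the coordinates of a curve by bounded Lipschitz functions. -/
theorem HasApproxVelocity.scale {n : ℕ} {y : ℝ → Vec n} {β : ℝ → Fin n → ℝ} {η : Vec n}
    {Λ τ t Y B : ℝ} {K : ℝ≥0} (h : HasApproxVelocity y η Λ t)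
    (hβ : LipschitzOnWith K β (Ico 0 τ)) (hY : ∀ s ∈ Ico 0 τ, ‖y s‖ ≤ Y) (hB0 : 0 < B)
    (hB : ∀ i, |β t i| ≤ B) (ht : t ∈ Ico 0 τ) :
    HasApproxVelocity (fun s => (WithLp.toLp 2 fun i => β s i * y s i : Vec n))
      (WithLp.toLp 2 fun i => β t i * η i) (B * Λ + K * Y) t := by
  intro ε hε
  filter_upwards [h (ε / B) (by positivity), hβ.eventually_norm_sub_le ht,
    Ioo_mem_nhdsGT ht.2] with s hs hβs hsI
  have hst : 0 < s - t := sub_pos.2 hsI.1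
  have h1 : ‖(WithLp.toLp 2 fun i => β t i * (y s - y t - (s - t) • η) i : Vec n)‖ ≤
      B * ‖y s - y t - (s - t) • η‖ := by
    refine norm_le_mul_norm hB0.le fun i => ?_
    rw [PiLp.toLp_apply, abs_mul]
    gcongr
    exact hB i
  have h2 : ‖(WithLp.toLp 2 fun i => (β s i - β t i) * y s i : Vec n)‖ ≤
      K * (s - t) * ‖y s‖ := by
    refine norm_le_mul_norm (by positivity) fun i => ?_
    rw [PiLp.toLp_apply, abs_mul]
    gcongr
    exact (norm_le_pi_norm (β s - β t) i).trans hβs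
  calc _ = ‖(WithLp.toLp 2 fun i => β t i * (y s - y t - (s - t) • η) i : Vec n) +
        (WithLp.toLp 2 fun i => (β s i - β t i) * y s i : Vec n)‖ := by
        congr 1
        ext i
        simp
        ring
    _ ≤ B * ((Λ + ε / B) * (s - t)) + K * (s - t) * Y := by
        refine (norm_add_le _ _).trans (add_le_add (h1.trans ?_) (h2.trans ?_))
        · gcongr
        · gcongr
          exact hY s ⟨ht.1.trans hsI.1.le, hsI.2⟩
    _ = (B * Λ + K * Y + ε) * (s - t) := by
        field_simp
        ring

/-- A barrier argument for a curve `e` that moves at each time `t` with velocity `η t` up to an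
error of size `Λ`. If `W` decreases along all these velocities whenever `W (e t) = θ`, then
`W (e t)` never exceeds `θ`. -/
theorem le_of_barrier {V : Type*} [NormedAddCommGroup V] [NormedSpace ℝ V] {e η : ℝ → V}
    {W : V → ℝ} {W' : ℝ → V →L[ℝ] ℝ} {Λ τ θ : ℝ} (hΛ : 0 ≤ Λ) (he : ContinuousOn e (Ico 0 τ))
    (hη : ∀ t ∈ Ico 0 τ, HasApproxVelocity e (η t) Λ t)
    (hW : ∀ t ∈ Ico 0 τ, HasFDerivAt W (W' t) (e t)) (h0 : W (e 0) ≤ θ)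
    (hneg : ∀ t ∈ Ico 0 τ, W (e t) = θ → W' t (η t) + ‖W' t‖ * Λ < 0) :
    ∀ t ∈ Ico 0 τ, W (e t) ≤ θ := by
  intro t ht
  have hsub : Icc 0 t ⊆ Ico 0 τ := fun s hs => ⟨hs.1, hs.2.trans_lt ht.2⟩
  refine image_le_of_liminf_slope_right_lt_deriv_boundary' (f := fun s => W (e s))
    (f' := fun s => W' s (η s) + ‖W' s‖ * Λ) (B := fun _ => θ) (B' := fun _ => 0) (a := 0) (b := t)
    (fun s hs => (hW s (hsub hs)).continuousAt.comp_continuousWithinAt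
      ((he s (hsub hs)).mono hsub)) ?_ h0 continuousOn_const
    (fun s _ => hasDerivWithinAt_const _ _ _)
    (fun s hs => hneg s (hsub (Ico_subset_Icc_self hs))) ⟨ht.1, le_rfl⟩
  intro s hs a ha
  have hs' : s ∈ Ico 0 τ := hsub (Ico_subset_Icc_self hs)
  -- `δ` bounds both the error of the velocity and that of the linearization of `W`
  set M := ‖W' s‖ + (‖η s‖ + Λ + 1) with hM
  have hM0 : 0 < M := by positivity
  obtain ⟨δ, hδ0, hδ1, hδ⟩ : ∃ δ > 0, δ ≤ 1 ∧
      W' s (η s) + ‖W' s‖ * Λ + δ * M < a := by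
    refine ⟨min 1 ((a - (W' s (η s) + ‖W' s‖ * Λ)) / (2 * M)),
      lt_min one_pos (div_pos (sub_pos.2 ha) (by positivity)), min_le_left _ _, ?_⟩
    have h1 : min 1 ((a - (W' s (η s) + ‖W' s‖ * Λ)) / (2 * M)) * M ≤
        (a - (W' s (η s) + ‖W' s‖ * Λ)) / (2 * M) * M := by
      gcongr
      exact min_le_right _ _
    have h2 : (a - (W' s (η s) + ‖W' s‖ * Λ)) / (2 * M) * M =
        (a - (W' s (η s) + ‖W' s‖ * Λ)) / 2 := by field_simp
    rw [h2] at h1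
    linarith
  have hcont : Tendsto e (𝓝[>] s) (𝓝 (e s)) := by
    refine (he s hs').mono_left (nhdsWithin_le_of_mem ?_)
    exact mem_of_superset (Ioo_mem_nhdsGT hs'.2) fun q hq => ⟨hs.1.trans hq.1.le, hq.2⟩
  have hlit := hcont.eventually ((hW s hs').isLittleO.def hδ0)
  refine Eventually.frequently ?_
  filter_upwards [hlit, hη s hs' δ hδ0, self_mem_nhdsWithin] with q hq hηq hsq
  have hsq' : 0 < q - s := sub_pos.2 hsq
  have hnorm : ‖e q - e s‖ ≤ (‖η s‖ + Λ + 1) * (q - s) := by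
    calc ‖e q - e s‖ = ‖(e q - e s - (q - s) • η s) + (q - s) • η s‖ := by rw [sub_add_cancel]
      _ ≤ (Λ + δ) * (q - s) + (q - s) * ‖η s‖ := by
        refine (norm_add_le _ _).trans (add_le_add hηq ?_)
        rw [norm_smul, Real.norm_of_nonneg hsq'.le]
      _ ≤ (Λ + 1) * (q - s) + (q - s) * ‖η s‖ := by gcongr
      _ = _ := by ring
  have h1 : W' s (e q - e s) ≤ (q - s) * W' s (η s) + ‖W' s‖ * ((Λ + δ) * (q - s)) := by
    have : W' s (e q - e s) = (q - s) * W' s (η s) + W' s (e q - e s - (q - s) • η s) := by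
      rw [map_sub (W' s) (e q - e s), map_smul, smul_eq_mul]
      ring
    rw [this]
    gcongr
    exact (le_abs_self _).trans (((W' s).le_opNorm _).trans (by gcongr))
  have h2 : W (e q) - W (e s) ≤ W' s (e q - e s) + δ * ((‖η s‖ + Λ + 1) * (q - s)) := by
    have := (le_abs_self _).trans (hq.trans (mul_le_mul_of_nonneg_left hnorm hδ0.le))
    linarith
  rw [slope_def_field, div_lt_iff₀ hsq']
  calc W (e q) - W (e s) ≤ (W' s (η s) + ‖W' s‖ * Λ + δ * M) * (q - s) := by
        rw [hM]
        linarith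
    _ < a * (q - s) := by gcongr

end Curves

/-! ### The barriers of the stages -/

section Transf

theorem transf_neg {e : ℝ} : transf (-e) = -transf e := by
  rw [transf, transf, ← Real.log_inv, inv_div, sub_neg_eq_add, ← sub_eq_add_neg]

theorem hasDerivAt_transf {e : ℝ} (he : |e| < 1) : HasDerivAt transf (2 / (1 - e ^ 2)) e := by
  obtain ⟨h1, h2⟩ := abs_lt.1 he
  have h3 : 1 - e ≠ 0 := by linarith
  have h5 : 1 + e ≠ 0 := by linarith
  have h4 : (1 + e) / (1 - e) ≠ 0 := div_ne_zero h5 h3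
  have := ((((hasDerivAt_id e).const_add 1).fun_div ((hasDerivAt_id e).const_sub 1) h3).log h4)
  refine this.congr_deriv ?_
  have h6 : 1 - e ^ 2 ≠ 0 := by
    have : 1 - e ^ 2 = (1 - e) * (1 + e) := by ring
    rw [this]
    exact mul_ne_zero h3 h5
  simp only [id]
  field_simp
  ring

/-- The inverse of `transf` is `C ↦ 1 - 2 / (exp C + 1)`. -/
theorem le_transf_iff {e C : ℝ} (h1 : -1 < e) (h2 : e < 1) :
    C ≤ transf e ↔ 1 - 2 / (Real.exp C + 1) ≤ e := by
  have h3 : 0 < 1 - e := by linarith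
  have h4 : 0 < Real.exp C + 1 := by positivity
  rw [transf, Real.le_log_iff_exp_le (div_pos (by linarith) h3), le_div_iff₀ h3, sub_le_comm,
    le_div_iff₀ h4]
  constructor <;> intro h <;> linarith

theorem abs_le_of_abs_transf_le {e C : ℝ} (he : |e| < 1) (h : |transf e| ≤ C) :
    |e| ≤ 1 - 2 / (Real.exp C + 1) := by
  obtain ⟨h1, h2⟩ := abs_lt.1 he
  have key : ∀ x : ℝ, -1 < x → x < 1 → transf x ≤ C → x ≤ 1 - 2 / (Real.exp C + 1) := by
    intro x hx1 hx2 hx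
    by_contra! hlt
    have h3 : 0 < 1 - x := by linarith
    have h4 : 0 < Real.exp C + 1 := by positivity
    rw [transf, Real.log_le_iff_le_exp (div_pos (by linarith) h3), div_le_iff₀ h3] at hx
    rw [sub_lt_comm, lt_div_iff₀ h4] at hlt
    linarith
  obtain ⟨h3, h4⟩ := abs_le.1 h
  refine abs_le'.2 ⟨key e h1 h2 h4, key (-e) (by linarith) (by linarith) ?_⟩
  rw [transf_neg]
  linarith

theorem one_sub_two_div_exp_lt_one (C : ℝ) : 1 - 2 / (Real.exp C + 1) < 1 := by
  have : 0 < 2 / (Real.exp C + 1) := by positivity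
  linarith

end Transf

section Barriers

variable {N n : ℕ}

theorem _root_.LipschitzOnWith.exists_norm_le {V : Type*} [NormedAddCommGroup V]
    {R : ℝ → V} {τ : ℝ} {L : ℝ≥0} (hR : LipschitzOnWith L R (Ico 0 τ)) :
    ∃ B > 0, ∀ t ∈ Ico 0 τ, ‖R t‖ ≤ B := by
  refine ⟨‖R 0‖ + L * |τ| + 1, by positivity, fun t ht => ?_⟩
  have h1 := hR.norm_sub_le ht ⟨le_rfl, ht.1.trans_lt ht.2⟩
  have h2 : ‖R t‖ ≤ ‖R 0‖ + ‖R t - R 0‖ := by simpa using norm_add_le (R 0) (R t - R 0)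
  have h3 : ‖t - 0‖ ≤ |τ| := by
    rw [sub_zero, Real.norm_of_nonneg ht.1]
    exact ht.2.le.trans (le_abs_self τ)
  have h4 : (L : ℝ) * ‖t - 0‖ ≤ L * |τ| := by gcongr
  linarith

theorem ContinuousOn.scale {y : ℝ → Vec n} {β : ℝ → Fin n → ℝ} {s : Set ℝ}
    (hβ : ContinuousOn β s) (hy : ContinuousOn y s) :
    ContinuousOn (fun t => (WithLp.toLp 2 fun i => β t i * y t i : Vec n)) s := by
  refine (PiLp.continuous_toLp 2 _).comp_continuousOn (continuousOn_pi.2 fun i => ?_)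
  exact ((continuous_apply i).comp_continuousOn hβ).mul
    ((EuclideanSpace.proj (𝕜 := ℝ) i).continuous.comp_continuousOn hy)

/-- The first stage keeps the normalized output error away from `1`. Along the boundary of a
slightly smaller tube, the feedback dominates all other terms. -/
theorem exists_outErr_le {x c : ℝ → Vec n} {r : ℝ → ℝ} {G : ℝ → Matrix (Fin n) (Fin n) ℝ}
    {κ b Λ τ : ℝ} {L K : ℝ≥0} (hκ : 0 < κ) (hb : 0 < b) (hΛ : 0 ≤ Λ)
    (hx : ContinuousOn x (Ico 0 τ)) (hc : LipschitzOnWith L c (Ico 0 τ))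
    (hr : LipschitzOnWith K (fun t => (r t)⁻¹) (Ico 0 τ))
    {rmax : ℝ} (hrmax : ∀ t ∈ Ico 0 τ, r t ≤ rmax)
    (hadm : ∀ t ∈ Ico 0 τ, ‖x t - c t‖ < r t)
    (hG : ∀ t ∈ Ico 0 τ, ∀ v, b * ‖v‖ ^ 2 ≤ inner ℝ v (act (G t) v))
    (hvel : ∀ t ∈ Ico 0 τ, HasApproxVelocity x
      (act (G t) (-(κ * transf (outErr c r t (x t))) • (x t - c t))) Λ t) :
    ∃ ρ < 1, ∀ t ∈ Ico 0 τ, ‖x t - c t‖ ≤ ρ * r t := by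
  obtain ⟨B, hB0, hB⟩ := hr.exists_norm_le
  have hr0 : ∀ t ∈ Ico 0 τ, 0 < r t := fun t ht => (norm_nonneg _).trans_lt (hadm t ht)
  rcases le_or_gt τ 0 with hτ | hτ
  · exact ⟨0, one_pos, fun t ht => absurd ht.2 (not_lt.2 (hτ.trans ht.1))⟩
  have h0 : (0 : ℝ) ∈ Ico 0 τ := ⟨le_rfl, hτ⟩
  set e : ℝ → Vec n := fun t => WithLp.toLp 2 fun i => (r t)⁻¹ * (x t - c t) i with he
  have he' : ∀ t, e t = (r t)⁻¹ • (x t - c t) := fun t => by ext i; simp [he]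
  have hen : ∀ t ∈ Ico 0 τ, ‖e t‖ = outErr c r t (x t) := fun t ht => by
    rw [he', norm_smul, norm_inv, Real.norm_of_nonneg (hr0 t ht).le, outErr, div_eq_inv_mul]
  have he1 : ∀ t ∈ Ico 0 τ, ‖e t‖ < 1 := fun t ht => by
    rw [hen t ht, outErr, div_lt_one (hr0 t ht)]
    exact hadm t ht
  set Λ' : ℝ := B * (Λ + L) + K * rmax with hΛ'
  have hrmax0 : 0 ≤ rmax := (hr0 0 h0).le.trans (hrmax 0 h0)
  have hΛ'0 : 0 ≤ Λ' := by positivity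
  have hβ : LipschitzOnWith K (fun t (_ : Fin n) => (r t)⁻¹) (Ico 0 τ) :=
    fun s hs t ht => edist_pi_le_iff.2 fun _ => hr hs ht
  -- `transf e ≥ C` and `e ≥ 1 / 2` make the feedback `κ * transf e * b * e` larger than `Λ'`
  set C : ℝ := 2 * Λ' / (κ * b) + 1 with hC
  set ρ : ℝ := max (max (1 / 2) ‖e 0‖) (1 - 2 / (Real.exp C + 1)) with hρ
  have hρ1 : ρ < 1 :=
    max_lt (max_lt (by norm_num) (he1 0 h0)) (one_sub_two_div_exp_lt_one C)
  have hρ2 : 1 / 2 ≤ ρ := (le_max_left _ _).trans (le_max_left _ _)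
  have hρ0 : 0 ≤ ρ := by linarith
  refine ⟨ρ, hρ1, fun t ht => ?_⟩
  have key := le_of_barrier (e := e)
    (η := fun t => WithLp.toLp 2 fun i => (r t)⁻¹ *
      (act (G t) (-(κ * transf (outErr c r t (x t))) • (x t - c t))) i)
    (W := fun v => ‖v‖ ^ 2) (W' := fun t => 2 • innerSL ℝ (e t)) (Λ := Λ') (θ := ρ ^ 2) hΛ'0
    (ContinuousOn.scale hβ.continuousOn (hx.sub hc.continuousOn))
    (fun t ht => ((hvel t ht).sub_lipschitz hc ht).scale hβ
      (fun s hs => (hadm s hs).le.trans (hrmax s hs)) hB0 (fun _ => hB t ht) ht)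
    (fun t ht => (hasStrictFDerivAt_norm_sq (e t)).hasFDerivAt)
    (pow_le_pow_left₀ (norm_nonneg _) ((le_max_right _ _).trans (le_max_left _ _)) 2)
    ?_ t ht
  · have h1 := abs_le_of_sq_le_sq key hρ0
    rw [abs_le] at h1
    have h2 := h1.2
    rw [hen t ht, outErr, div_le_iff₀ (hr0 t ht)] at h2
    exact h2
  · intro t ht hθ
    have hr' := hr0 t ht
    have heρ : ‖e t‖ = ρ :=
      (pow_left_inj₀ (norm_nonneg _) hρ0 two_ne_zero).1 hθ
    have heta : (WithLp.toLp 2 fun i => (r t)⁻¹ *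
        (act (G t) (-(κ * transf (outErr c r t (x t))) • (x t - c t))) i : Vec n) =
        -(κ * transf ρ) • act (G t) (e t) := by
      rw [← heρ, hen t ht, he', act_smul, act_smul]
      ext i
      simp
      ring
    have htr : C ≤ transf ρ := (le_transf_iff (by linarith) hρ1).2 (le_max_right _ _)
    have hκb : 0 < κ * b := mul_pos hκ hb
    have hC0 : 0 ≤ C := by positivity
    have htr0 : 0 ≤ transf ρ := hC0.trans htr
    have hG' := hG t ht (e t)
    rw [heρ] at hG'
    have hnorm : ‖(2 • innerSL ℝ (e t) : Vec n →L[ℝ] ℝ)‖ ≤ 2 * ρ := by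
      rw [← Nat.cast_smul_eq_nsmul ℝ, norm_smul, innerSL_apply_norm, heρ]
      simp
    have h3 : Λ' < κ * transf ρ * b * ρ := by
      have : κ * b * C = 2 * Λ' + κ * b := by
        rw [hC]
        field_simp
      calc Λ' < κ * b * C * (1 / 2) := by rw [this]; linarith
        _ ≤ κ * b * transf ρ * ρ := by gcongr
        _ = _ := by ring
    have h4 : κ * transf ρ * (b * ρ ^ 2) ≤ κ * transf ρ * inner ℝ (e t) (act (G t) (e t)) :=
      mul_le_mul_of_nonneg_left hG' (mul_nonneg hκ.le (hC0.trans htr))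
    have h5 : ‖(2 • innerSL ℝ (e t) : Vec n →L[ℝ] ℝ)‖ * Λ' ≤ 2 * ρ * Λ' := by gcongr
    have h6 : ρ * Λ' < ρ * (κ * transf ρ * b * ρ) :=
      mul_lt_mul_of_pos_left h3 (by linarith)
    simp only [heta]
    have h7 : (2 • innerSL ℝ (e t) : Vec n →L[ℝ] ℝ) (-(κ * transf ρ) • act (G t) (e t)) =
        -2 * (κ * transf ρ * inner ℝ (e t) (act (G t) (e t))) := by
      simp [inner_smul_right]
    rw [h7]
    nlinarith

/-- A later stage keeps the transformed errors bounded: the feedback dominates all other terms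
where the sum of their squares is large. -/
theorem Design.exists_abs_transf_le (D : Design N n) (k : Fin N) {x R : ℝ → Vec n}
    {G : ℝ → Matrix (Fin n) (Fin n) ℝ} {b Λ τ : ℝ} {L : ℝ≥0} (hb : 0 < b) (hΛ : 0 ≤ Λ)
    (hx : ContinuousOn x (Ico 0 τ)) (hR : LipschitzOnWith L R (Ico 0 τ))
    (hadm : ∀ t ∈ Ico 0 τ, ∀ i, |x t i - R t i| < D.γ k t i)
    (hG : ∀ t ∈ Ico 0 τ, ∀ v, b * ‖v‖ ^ 2 ≤ inner ℝ v (act (G t) v))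
    (hvel : ∀ t ∈ Ico 0 τ, HasApproxVelocity x
      (act (G t) (D.laterStage k t (x t) (R t))) Λ t) :
    ∃ C, ∀ t ∈ Ico 0 τ, ∀ i, |transf (D.err k t (x t) (R t) i)| ≤ C := by
  have hκ := D.κ_pos k
  obtain ⟨K, hK⟩ : ∃ K, LipschitzOnWith K (fun t i => (D.γ k t i)⁻¹) (Icc 0 τ) := by
    refine exists_lipschitzOnWith_of_lipschitzNear isCompact_Icc fun t ht => LipschitzNear.pi
      fun i => LipschitzNear.contDiffAt_comp (g := fun t => (D.γ k t i)⁻¹)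
        ((D.contDiff_γ k i).contDiffAt.inv (D.γ_pos k _ i).ne')
        (LipschitzNear.of_lipschitzWith LipschitzWith.id) ht
  have hβ := hK.mono Ico_subset_Icc_self
  obtain ⟨B, hB0, hB⟩ := hβ.exists_norm_le
  have hp0 : ∀ i, 0 < D.p k i := fun i => (D.q_pos k i).trans (D.q_lt_p k i)
  -- a common bound for all `γ k t i`, positive also for `n = 0`
  set p : ℝ := 1 + ∑ i, D.p k i with hp
  have hpi : ∀ i, D.p k i ≤ p := fun i => by
    have := Finset.single_le_sum (f := D.p k) (fun j _ => (hp0 j).le) (Finset.mem_univ i)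
    linarith
  have hp1 : 0 < p := by
    have := Finset.sum_nonneg fun i (_ : i ∈ Finset.univ) => (hp0 i).le
    linarith
  have hγp : ∀ t ∈ Ico 0 τ, ∀ i, D.γ k t i ≤ p := fun t ht i => (D.γ_le k ht.1 i).trans (hpi i)
  set e : ℝ → Vec n := fun t => WithLp.toLp 2 fun i => (D.γ k t i)⁻¹ * (x t - R t) i with he
  have hei : ∀ t i, e t i = D.err k t (x t) (R t) i := fun t i => by
    simp [he, Design.err, div_eq_inv_mul]
  have he1 : ∀ t ∈ Ico 0 τ, ∀ i, |e t i| < 1 := fun t ht i => by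
    rw [hei]
    exact D.abs_err_lt_one (hadm t ht i)
  -- the feedback is `-κ • v`
  set v : ℝ → Vec n := fun t => WithLp.toLp 2 fun i =>
    4 * (D.γ k t i)⁻¹ * (1 - e t i ^ 2)⁻¹ * transf (e t i) with hv
  have hlater : ∀ t, D.laterStage k t (x t) (R t) = -D.κ k • v t := fun t => by
    ext i
    simp [D.laterStage_apply, hv, hei]
  set Λ' : ℝ := B * (Λ + L) + K * p with hΛ'
  have hΛ'0 : 0 ≤ Λ' := by positivity
  have hY : ∀ t ∈ Ico 0 τ, ‖x t - R t‖ ≤ p := fun t ht => by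
    refine (norm_le_sum_abs _).trans ?_
    have : ∑ i, |(x t - R t) i| ≤ ∑ i, D.p k i :=
      Finset.sum_le_sum fun i _ => (hadm t ht i).le.trans (D.γ_le k ht.1 i)
    linarith
  -- the gradient of the barrier `W` at `e t`: up to the factors `γ / 2` it is `v`, so that the
  -- velocity `γ⁻¹ * G * (-κ • v)` of `e` changes `W` at the rate `-κ / 2 * ⟪v, G v⟫`
  set grad : ℝ → Vec n := fun t => WithLp.toLp 2 fun i => D.γ k t i * v t i / 2 with hgrad
  have hgradn : ∀ t ∈ Ico 0 τ, ‖grad t‖ ≤ p / 2 * ‖v t‖ := fun t ht => by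
    refine norm_le_mul_norm (by positivity) fun i => ?_
    rw [hgrad, PiLp.toLp_apply, abs_div, abs_mul, abs_of_pos (D.γ_pos k t i), abs_two,
      div_mul_eq_mul_div]
    gcongr
    exact hγp t ht i
  set W : Vec n → ℝ := fun z => ∑ i, transf (z i) ^ 2 / 2 with hW
  have hderiv : ∀ t ∈ Ico 0 τ, HasFDerivAt W (innerSL ℝ (grad t)) (e t) := fun t ht => by
    have h1 : HasFDerivAt W (∑ i, ((2 * transf (e t i) * (2 / (1 - e t i ^ 2))) / 2) •
        (EuclideanSpace.proj (𝕜 := ℝ) i : Vec n →L[ℝ] ℝ)) (e t) := by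
      refine HasFDerivAt.fun_sum fun i _ => ?_
      have h2 := ((hasDerivAt_transf (he1 t ht i)).fun_pow 2).div_const 2
      refine HasDerivAt.comp_hasFDerivAt (h₂ := fun y => transf y ^ 2 / 2) (e t)
        (f := fun z : Vec n => z i) ?_
        (EuclideanSpace.proj (𝕜 := ℝ) i : Vec n →L[ℝ] ℝ).hasFDerivAt
      simpa using h2
    refine h1.congr_fderiv ?_
    ext z
    simp only [_root_.sum_apply, _root_.smul_apply, innerSL_apply_apply,
      PiLp.inner_apply, hgrad, hv, smul_eq_mul]
    refine Finset.sum_congr rfl fun i _ => ?_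
    have := (D.γ_pos k t i).ne'
    simp
    field_simp
    ring
  -- the feedback dominates where `‖v‖ ≥ m`; this holds where `W = θ`, as `|transf e| ≤ p / 4 * |v|`
  set m : ℝ := p * Λ' / (2 * (D.κ k * b / 2)) + 1 with hm
  have hm0 : 0 < m := by positivity
  set θ : ℝ := max (W (e 0)) ((p / 4 * m) ^ 2 / 2) with hθ
  have key := le_of_barrier (e := e)
    (η := fun t => WithLp.toLp 2 fun i => (D.γ k t i)⁻¹ *
      (act (G t) (D.laterStage k t (x t) (R t))) i)
    (W := W) (W' := fun t => innerSL ℝ (grad t)) (Λ := Λ') (θ := θ) hΛ'0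
    (ContinuousOn.scale hβ.continuousOn (hx.sub hR.continuousOn))
    (fun t ht => ((hvel t ht).sub_lipschitz hR ht).scale hβ hY hB0
      (fun i => (norm_le_pi_norm (fun i => (D.γ k t i)⁻¹) i).trans (hB t ht)) ht)
    hderiv (le_max_left _ _) ?_
  · refine ⟨√(2 * θ), fun t ht i => Real.abs_le_sqrt ?_⟩
    rw [← hei]
    have h1 : transf (e t i) ^ 2 / 2 ≤ W (e t) :=
      Finset.single_le_sum (f := fun i => transf (e t i) ^ 2 / 2)
        (fun j _ => by positivity) (Finset.mem_univ i)
    have h2 := key t ht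
    linarith
  · intro t ht hWθ
    have hvm : m ≤ ‖v t‖ := by
      have h1 : ‖(WithLp.toLp 2 fun i => transf (e t i) : Vec n)‖ ≤ p / 4 * ‖v t‖ := by
        refine norm_le_mul_norm (by positivity) fun i => ?_
        have hγ := D.γ_pos k t i
        have hsq : 0 < 1 - e t i ^ 2 := by
          have := (sq_lt_one_iff_abs_lt_one _).2 (he1 t ht i)
          linarith
        have hsq1 : 1 ≤ (1 - e t i ^ 2)⁻¹ :=
          (one_le_inv₀ hsq).2 (by linarith [sq_nonneg (e t i)])
        have hvi : v t i = 4 * (D.γ k t i)⁻¹ * (1 - e t i ^ 2)⁻¹ * transf (e t i) := rfl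
        rw [PiLp.toLp_apply, hvi, abs_mul,
          abs_of_pos (a := 4 * (D.γ k t i)⁻¹ * (1 - e t i ^ 2)⁻¹) (by positivity)]
        have h2 : 1 ≤ p * (D.γ k t i)⁻¹ := by
          rw [← div_eq_mul_inv, one_le_div hγ]
          exact hγp t ht i
        calc |transf (e t i)| ≤ (p * (D.γ k t i)⁻¹) * (1 - e t i ^ 2)⁻¹ * |transf (e t i)| :=
              le_mul_of_one_le_left (abs_nonneg _) (one_le_mul_of_one_le_of_one_le h2 hsq1)
          _ = _ := by ring
      have h2 : ‖(WithLp.toLp 2 fun i => transf (e t i) : Vec n)‖ ^ 2 = 2 * W (e t) := by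
        rw [EuclideanSpace.norm_sq_eq, hW, Finset.mul_sum]
        refine Finset.sum_congr rfl fun i _ => ?_
        simp
        ring
      have h3 : (p / 4 * m) ^ 2 ≤ (p / 4 * ‖v t‖) ^ 2 := by
        calc (p / 4 * m) ^ 2 ≤ 2 * W (e t) := by
              rw [hWθ]
              linarith [le_max_right (W (e 0)) ((p / 4 * m) ^ 2 / 2)]
          _ ≤ _ := by
              rw [← h2]
              gcongr
      have h4 := le_of_sq_le_sq h3 (by positivity)
      exact le_of_mul_le_mul_left h4 (by positivity)
    have h1 : innerSL ℝ (grad t) (WithLp.toLp 2 fun i => (D.γ k t i)⁻¹ *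
        (act (G t) (D.laterStage k t (x t) (R t))) i : Vec n) =
        -(D.κ k / 2) * inner ℝ (v t) (act (G t) (v t)) := by
      rw [hlater, act_smul, innerSL_apply_apply, PiLp.inner_apply, PiLp.inner_apply,
        Finset.mul_sum]
      refine Finset.sum_congr rfl fun i _ => ?_
      have := (D.γ_pos k t i).ne'
      simp only [hgrad, PiLp.toLp_apply, PiLp.smul_apply, smul_eq_mul, RCLike.inner_apply,
        conj_trivial]
      field_simp
    rw [h1, innerSL_apply_norm]
    have h2 := hgradn t ht
    have h3 : D.κ k / 2 * (b * ‖v t‖ ^ 2) ≤ D.κ k / 2 * inner ℝ (v t) (act (G t) (v t)) :=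
      mul_le_mul_of_nonneg_left (hG t ht _) (by positivity)
    have h4 : ‖grad t‖ * Λ' ≤ p / 2 * ‖v t‖ * Λ' := by gcongr
    have h5 : p / 2 * Λ' < D.κ k / 2 * b * ‖v t‖ := by
      have : D.κ k / 2 * b * m = p / 2 * Λ' + D.κ k / 2 * b := by
        rw [hm]
        field_simp
      have h6 : D.κ k / 2 * b * m ≤ D.κ k / 2 * b * ‖v t‖ := by gcongr
      have h7 : 0 < D.κ k / 2 * b := by positivity
      linarith
    have h6 := mul_lt_mul_of_pos_left h5 (hm0.trans_le hvm)
    linarith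

end Barriers

/-! ### Bounds along trajectories -/

section Coefficients

variable {N n : ℕ} {S : PureFeedbackSystem N n} {x : ℝ → Fin N → Vec n} {τ : ℝ}

theorem continuousOn_trunc {J : Set ℝ} (hx : ContinuousOn x J) (i : Fin N) :
    ContinuousOn (fun t => trunc i (x t)) J :=
  continuousOn_pi.2 fun j => (continuous_apply (Fin.castLE i.isLt j)).comp_continuousOn hx

theorem PureFeedbackSystem.LocLipschitz.continuousOn_act (hlip : S.LocLipschitz) {J : Set ℝ}
    {v : ℝ → Vec n} (hx : ContinuousOn x J) (hmem : ∀ t ∈ J, ∀ i, x t i ∈ S.X i)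
    (hv : ContinuousOn v J) (i : Fin N) :
    ContinuousOn (fun t => act (S.g i (trunc i (x t))) (v t)) J := by
  refine (PiLp.continuous_toLp 2 _).comp_continuousOn (continuousOn_pi.2 fun a => ?_)
  refine continuousOn_finsetSum (s := Finset.univ)
    (f := fun b t => S.g i (trunc i (x t)) a b * v t b) fun b _ => ?_
  refine ContinuousOn.mul ?_
    ((EuclideanSpace.proj (𝕜 := ℝ) b).continuous.comp_continuousOn hv)
  exact ((hlip i).2 a b).continuousOn.comp (continuousOn_trunc hx i)
    fun t ht => S.trunc_mem_dom (hmem t ht)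

/-- Bounds for `f i` and `g i` along a trajectory on `[0, τ)` whose first blocks are bounded and do
not leave the state sets in the limit. -/
theorem PureFeedbackSystem.LocLipschitz.exists_bound (hlip : S.LocLipschitz)
    (hx : ContinuousOn x (Ico 0 τ)) (hmem : ∀ t ∈ Ico 0 τ, ∀ i, x t i ∈ S.X i)
    (hcl : ∀ i z, MapClusterPt z (𝓝[<] τ) (fun t => x t i) → z ∈ S.X i) (i : Fin N)
    (hbd : ∀ j ≤ i, ∃ C, ∀ t ∈ Ico 0 τ, ‖x t j‖ ≤ C) :
    ∃ B ≥ 0, ∀ t ∈ Ico 0 τ, ‖S.f i (trunc i (x t))‖ ≤ B ∧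
      ∑ a, ∑ b, |S.g i (trunc i (x t)) a b| ≤ B := by
  have hbd' : ∃ C, ∀ t ∈ Ico 0 τ, ‖trunc i (x t)‖ ≤ C := by
    have h1 : ∀ j : Fin ((i : ℕ) + 1), ∃ C, ∀ t ∈ Ico 0 τ, ‖x t (Fin.castLE i.isLt j)‖ ≤ C :=
      fun j => hbd _ (Fin.le_def.2 (Nat.lt_succ_iff.1 j.isLt))
    choose C hC using h1
    refine ⟨∑ j, |C j|, fun t ht => (pi_norm_le_iff_of_nonneg
      (Finset.sum_nonneg fun j _ => abs_nonneg _)).2 fun j => ?_⟩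
    exact ((hC j t ht).trans (le_abs_self _)).trans
      (Finset.single_le_sum (f := fun j => |C j|) (fun j _ => abs_nonneg _) (Finset.mem_univ j))
  obtain ⟨C, hC⟩ := hbd'
  have key : ∀ φ : (Fin ((i : ℕ) + 1) → Vec n) → ℝ, ContinuousOn φ (S.dom i) →
      ∃ B, ∀ t ∈ Ico 0 τ, φ (trunc i (x t)) ≤ B := fun φ hφ =>
    exists_le_of_cluster_mem (continuousOn_trunc hx i) hC
      (fun t ht => S.trunc_mem_dom (hmem t ht))
      (fun z hz j => hcl _ _ (hz.continuousAt_comp (continuous_apply j).continuousAt)) hφ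
  obtain ⟨B₁, hB₁⟩ := key (fun z => ‖S.f i z‖) (hlip i).1.continuousOn.norm
  obtain ⟨B₂, hB₂⟩ := key (fun z => ∑ a, ∑ b, |S.g i z a b|)
    (continuousOn_finsetSum _ fun a _ => continuousOn_finsetSum _ fun b _ =>
      ((hlip i).2 a b).continuousOn.abs)
  exact ⟨max (max B₁ B₂) 0, le_max_right _ _, fun t ht =>
    ⟨(hB₁ t ht).trans ((le_max_left _ _).trans (le_max_left _ _)),
      (hB₂ t ht).trans ((le_max_right _ _).trans (le_max_left _ _))⟩⟩

end Coefficients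

section Trajectory

variable {N n : ℕ} [NeZero N] {S : PureFeedbackSystem N n} {D : Design N n} {c : ℝ → Vec n}
  {r : ℝ → ℝ} {w : ℝ → Fin N → Vec n} {x₀ : Fin N → Vec n} {x : ℝ → Fin N → Vec n} {τ : ℝ}

/-- For an admissible state, the quantity that multiplies `g i` differs from the output of stage
`i` by an error within the performance bounds. -/
theorem Design.exists_norm_next_sub_stage_le (D : Design N n) (c : ℝ → Vec n) (r : ℝ → ℝ) :
    ∃ C ≥ 0, ∀ t ≥ 0, ∀ x, D.Admissible c r t x → ∀ i : Fin N,
      ‖next x (D.control c r t x) i - D.stage c r t x i i.isLt‖ ≤ C := by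
  have hp0 : ∀ k i, 0 < D.p k i := fun k i => (D.q_pos k i).trans (D.q_lt_p k i)
  refine ⟨∑ k, ∑ i, D.p k i, Finset.sum_nonneg fun k _ => Finset.sum_nonneg fun i _ =>
    (hp0 k i).le, fun t ht x hx i => ?_⟩
  by_cases h : (i : ℕ) + 1 < N
  · rw [next, dif_pos h]
    calc _ ≤ ∑ a, D.p ⟨i + 1, h⟩ a := (norm_le_sum_abs _).trans
          (Finset.sum_le_sum fun a _ => (hx.2 i h a).le.trans (D.γ_le _ ht a))
      _ ≤ _ := Finset.single_le_sum (f := fun k => ∑ a, D.p k a)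
          (fun k _ => Finset.sum_nonneg fun i _ => (hp0 k i).le) (Finset.mem_univ _)
  · obtain ⟨i, hi⟩ := i
    obtain rfl : i = N - 1 := by
      simp only at h
      omega
    rw [next, dif_neg h, Design.control, sub_self, norm_zero]
    exact Finset.sum_nonneg fun k _ => Finset.sum_nonneg fun i _ => (hp0 k i).le

theorem Design.continuousOn_stage (hc : ContDiffOn ℝ 1 c (Ici 0)) (hr : ContDiffOn ℝ 1 r (Ici 0))
    {J : Set ℝ} (hJ : J ⊆ Ici 0) (hx : ContinuousOn x J)
    (hadm : ∀ t ∈ J, D.Admissible c r t (x t)) (k : ℕ) (hk : k < N) :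
    ContinuousOn (fun t => D.stage c r t (x t) k hk) J := by
  intro t ht
  have hmem : ((t, x t) : ℝ × (Fin N → Vec n)) ∈ Ici (0 : ℝ) ×ˢ (univ : Set (Fin N → Vec n)) :=
    ⟨hJ ht, mem_univ _⟩
  have h1 := (D.lipschitzNear_stage hc hr (t := Prod.fst) (x := Prod.snd) hmem
    (LipschitzNear.of_lipschitzWith LipschitzWith.prod_fst) (fun p hp => hp.1) k hk
    (fun j _ => LipschitzNear.of_lipschitzWith ((LipschitzWith.eval j).comp LipschitzWith.prod_snd))
    ((hadm t ht).upTo k)).continuousWithinAt hmem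
  exact ContinuousWithinAt.comp (f := fun t => (t, x t)) h1
    (continuousWithinAt_id.prodMk (hx t ht)) fun s hs => ⟨hJ hs, mem_univ _⟩

theorem IsClosedLoop.intervalIntegrable (hx : IsClosedLoop S D c r w x₀ (Ico 0 τ) x) {s t : ℝ}
    (hs : s ∈ Ico 0 τ) (ht : t ∈ Ico 0 τ) (i : Fin N) :
    IntervalIntegrable (fun q => S.rhs (x q) (D.control c r q (x q)) (w q) i) volume t s :=
  (hx.integrable t ht i).symm.trans (hx.integrable s hs i)

theorem IsClosedLoop.sub_eq_integral (hx : IsClosedLoop S D c r w x₀ (Ico 0 τ) x) {s t : ℝ}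
    (hs : s ∈ Ico 0 τ) (ht : t ∈ Ico 0 τ) (i : Fin N) :
    x s i - x t i = ∫ q in t..s, S.rhs (x q) (D.control c r q (x q)) (w q) i := by
  rw [hx.eq s hs i, hx.eq t ht i, add_sub_add_left_eq_sub,
    intervalIntegral.integral_interval_sub_left (hx.integrable s hs i) (hx.integrable t ht i)]

/-- The right-hand side of the equation of block `i` is the input matrix applied to the output of
stage `i`, up to a bounded term. -/
theorem exists_norm_rhs_sub_act_stage_le (hlip : S.LocLipschitz) (hW : Bornology.IsBounded S.W)
    (hw : ∀ t, 0 ≤ t → ∀ i, w t i ∈ S.W)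
    (hx : ContinuousOn x (Ico 0 τ)) (hmem : ∀ t ∈ Ico 0 τ, ∀ i, x t i ∈ S.X i)
    (hcl : ∀ i z, MapClusterPt z (𝓝[<] τ) (fun t => x t i) → z ∈ S.X i)
    (hadm : ∀ t ∈ Ico 0 τ, D.Admissible c r t (x t)) (i : Fin N)
    (hbd : ∀ j ≤ i, ∃ C, ∀ t ∈ Ico 0 τ, ‖x t j‖ ≤ C) :
    ∃ Λ ≥ 0, ∀ t ∈ Ico 0 τ, (∑ a, ∑ b, |S.g i (trunc i (x t)) a b| ≤ Λ) ∧
      ‖S.rhs (x t) (D.control c r t (x t)) (w t) i -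
        act (S.g i (trunc i (x t))) (D.stage c r t (x t) i i.isLt)‖ ≤ Λ := by
  obtain ⟨B, hB0, hB⟩ := hlip.exists_bound hx hmem hcl i hbd
  obtain ⟨C, hC0, hC⟩ := D.exists_norm_next_sub_stage_le c r
  obtain ⟨M, hM⟩ := isBounded_iff_forall_norm_le.1 hW
  refine ⟨B + B * C + |M|, by positivity, fun t ht => ⟨?_, ?_⟩⟩
  · have : 0 ≤ B * C + |M| := by positivity
    linarith [(hB t ht).2]
  · have h1 : S.rhs (x t) (D.control c r t (x t)) (w t) i -
        act (S.g i (trunc i (x t))) (D.stage c r t (x t) i i.isLt) =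
        S.f i (trunc i (x t)) + act (S.g i (trunc i (x t)))
          (next (x t) (D.control c r t (x t)) i - D.stage c r t (x t) i i.isLt) + w t i := by
      rw [act_sub, PureFeedbackSystem.rhs]
      simp only [act]
      abel
    rw [h1]
    refine norm_add₃_le.trans (add_le_add_three (hB t ht).1 ((norm_act_le _ _).trans ?_)
      ((hM _ (hw t ht.1 i)).trans (le_abs_self M)))
    exact mul_le_mul (hB t ht).2 (hC t ht.1 _ (hadm t ht) i) (norm_nonneg _) hB0

theorem IsClosedLoop.exists_hasApproxVelocity (hlip : S.LocLipschitz)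
    (hW : Bornology.IsBounded S.W) (hw : ∀ t, 0 ≤ t → ∀ i, w t i ∈ S.W)
    (hc : ContDiffOn ℝ 1 c (Ici 0)) (hr : ContDiffOn ℝ 1 r (Ici 0))
    (hx : IsClosedLoop S D c r w x₀ (Ico 0 τ) x)
    (hcl : ∀ i z, MapClusterPt z (𝓝[<] τ) (fun t => x t i) → z ∈ S.X i)
    (hadm : ∀ t ∈ Ico 0 τ, D.Admissible c r t (x t)) (i : Fin N)
    (hbd : ∀ j ≤ i, ∃ C, ∀ t ∈ Ico 0 τ, ‖x t j‖ ≤ C) :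
    ∃ Λ ≥ 0, ∀ t ∈ Ico 0 τ, HasApproxVelocity (fun t => x t i)
      (act (S.g i (trunc i (x t))) (D.stage c r t (x t) i i.isLt)) Λ t := by
  obtain ⟨Λ, hΛ0, hΛ⟩ :=
    exists_norm_rhs_sub_act_stage_le hlip hW hw hx.cont hx.mem hcl hadm i hbd
  refine ⟨Λ, hΛ0, fun t ht ε hε => ?_⟩
  have hcont := hlip.continuousOn_act hx.cont hx.mem
    (D.continuousOn_stage hc hr Ico_subset_Ici_self hx.cont hadm i i.isLt) i
  obtain ⟨δ, hδ, hδ'⟩ := Metric.continuousWithinAt_iff.1 (hcont t ht) ε hε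
  filter_upwards [Ioo_mem_nhdsGT (lt_min ht.2 (show t < t + δ by linarith))] with s hs
  have hsI : s ∈ Ico 0 τ := ⟨ht.1.trans hs.1.le, hs.2.trans_le (min_le_left _ _)⟩
  rw [hx.sub_eq_integral hsI ht, ← intervalIntegral.integral_const,
    ← intervalIntegral.integral_sub (hx.intervalIntegrable hsI ht i) intervalIntegrable_const]
  have := intervalIntegral.norm_integral_le_of_norm_le_const (a := t) (b := s) (C := Λ + ε)
    (f := fun q => S.rhs (x q) (D.control c r q (x q)) (w q) i -
      act (S.g i (trunc i (x t))) (D.stage c r t (x t) i i.isLt)) ?_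
  · rwa [abs_of_pos (sub_pos.2 hs.1)] at this
  · intro q hq
    rw [uIoc_of_le hs.1.le] at hq
    have hqI : q ∈ Ico 0 τ := ⟨ht.1.trans hq.1.le, hq.2.trans_lt hsI.2⟩
    have h1 := hδ' hqI (by
      rw [Real.dist_eq, abs_of_pos (sub_pos.2 hq.1)]
      linarith [hq.2, hs.2.trans_le (min_le_right τ (t + δ))])
    rw [dist_eq_norm] at h1
    refine (norm_sub_le_norm_sub_add_norm_sub _ (act (S.g i (trunc i (x q)))
      (D.stage c r q (x q) i i.isLt)) _).trans (add_le_add (hΛ q hqI).2 h1.le)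

theorem IsClosedLoop.exists_lipschitzOnWith (hlip : S.LocLipschitz)
    (hW : Bornology.IsBounded S.W) (hw : ∀ t, 0 ≤ t → ∀ i, w t i ∈ S.W)
    (hx : IsClosedLoop S D c r w x₀ (Ico 0 τ) x)
    (hcl : ∀ i z, MapClusterPt z (𝓝[<] τ) (fun t => x t i) → z ∈ S.X i)
    (hadm : ∀ t ∈ Ico 0 τ, D.Admissible c r t (x t)) (i : Fin N)
    (hbd : ∀ j ≤ i, ∃ C, ∀ t ∈ Ico 0 τ, ‖x t j‖ ≤ C)
    (hst : ∃ C, ∀ t ∈ Ico 0 τ, ‖D.stage c r t (x t) i i.isLt‖ ≤ C) :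
    ∃ K, LipschitzOnWith K (fun t => x t i) (Ico 0 τ) := by
  obtain ⟨Λ, hΛ0, hΛ⟩ :=
    exists_norm_rhs_sub_act_stage_le hlip hW hw hx.cont hx.mem hcl hadm i hbd
  obtain ⟨C, hC⟩ := hst
  refine ⟨⟨Λ + Λ * |C|, by positivity⟩, LipschitzOnWith.of_dist_le_mul fun s hs t ht => ?_⟩
  rw [dist_eq_norm, hx.sub_eq_integral hs ht, Real.dist_eq]
  refine intervalIntegral.norm_integral_le_of_norm_le_const fun q hq => ?_
  have hqI : q ∈ Ico 0 τ := by
    rcases le_total t s with h | h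
    · rw [uIoc_of_le h] at hq
      exact ⟨ht.1.trans hq.1.le, hq.2.trans_lt hs.2⟩
    · rw [uIoc_of_ge h] at hq
      exact ⟨hs.1.trans hq.1.le, hq.2.trans_lt ht.2⟩
  rw [← sub_add_cancel (S.rhs (x q) (D.control c r q (x q)) (w q) i)
    (act (S.g i (trunc i (x q))) (D.stage c r q (x q) i i.isLt))]
  refine (norm_add_le _ _).trans (add_le_add (hΛ q hqI).2 ((norm_act_le _ _).trans ?_))
  exact mul_le_mul (hΛ q hqI).1 ((hC q hqI).trans (le_abs_self C)) (norm_nonneg _) hΛ0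

end Trajectory

/-! ### The limit of an admissible trajectory -/

theorem Design.exists_norm_laterStage_le {N n : ℕ} (D : Design N n) (k : Fin N) (C : ℝ) :
    ∃ M, ∀ t (x ref : Vec n), (∀ i, |x i - ref i| < D.γ k t i) →
      (∀ i, |transf (D.err k t x ref i)| ≤ C) → ‖D.laterStage k t x ref‖ ≤ M := by
  set ρ := 1 - 2 / (Real.exp C + 1) with hρ
  refine ⟨∑ i, D.κ k * (4 * (D.q k i)⁻¹ * (1 - ρ ^ 2)⁻¹ * C), fun t x ref h hC => ?_⟩
  refine (norm_le_sum_abs _).trans (Finset.sum_le_sum fun i _ => ?_)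
  have he := D.abs_err_lt_one (h i)
  have hρe := abs_le_of_abs_transf_le he (hC i)
  have hρ1 : ρ < 1 := one_sub_two_div_exp_lt_one C
  have hρ0 : 0 ≤ ρ := (abs_nonneg _).trans hρe
  have hsq : D.err k t x ref i ^ 2 ≤ ρ ^ 2 := by
    rw [← sq_abs]
    exact pow_le_pow_left₀ (abs_nonneg _) hρe 2
  have hρ2 : 0 < 1 - ρ ^ 2 := by nlinarith
  have hq := D.q_pos k i
  have hκ := D.κ_pos k
  have hγ := D.γ_pos k t i
  have he2 : 0 < 1 - D.err k t x ref i ^ 2 := by linarith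
  rw [D.laterStage_apply, abs_mul, abs_neg, abs_of_pos hκ, abs_mul,
    abs_of_pos (a := 4 * (D.γ k t i)⁻¹ * (1 - D.err k t x ref i ^ 2)⁻¹) (by positivity)]
  gcongr
  · exact D.le_γ k t i
  · exact hC i

/-- A weak inequality between continuous functions extends from `[0, τ)` to `τ`. -/
theorem le_of_le_Ico {f g : ℝ → ℝ} (hτ : 0 < τ) (hf : ContinuousOn f (Icc 0 τ))
    (hg : ContinuousOn g (Icc 0 τ)) (h : ∀ t ∈ Ico 0 τ, f t ≤ g t) : f τ ≤ g τ := by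
  have hmem : τ ∈ Icc 0 τ := ⟨hτ.le, le_rfl⟩
  refine ContinuousWithinAt.closure_le (s := Ico 0 τ) ?_ ((hf τ hmem).mono Ico_subset_Icc_self)
    ((hg τ hmem).mono Ico_subset_Icc_self) h
  rw [closure_Ico hτ.ne]
  exact hmem

section Limit

variable {N n : ℕ} [NeZero N] {S : PureFeedbackSystem N n} {D : Design N n} {c : ℝ → Vec n}
  {r : ℝ → ℝ} {w : ℝ → Fin N → Vec n} {x₀ : Fin N → Vec n} {x : ℝ → Fin N → Vec n} {τ : ℝ}

/-- The stages are Lipschitz along a curve that is Lipschitz and admissible up to time `τ`. -/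
theorem Design.exists_lipschitzOnWith_stage (D : Design N n) (hc : ContDiffOn ℝ 1 c (Ici 0))
    (hr : ContDiffOn ℝ 1 r (Ici 0)) (k : ℕ) (hk : k < N)
    (hx : ∀ j : Fin N, (j : ℕ) ≤ k → ∃ K, LipschitzOnWith K (fun t => x t j) (Icc 0 τ))
    (hadm : ∀ t ∈ Icc 0 τ, D.AdmissibleUpTo c r t (x t) k) :
    ∃ K, LipschitzOnWith K (fun t => D.stage c r t (x t) k hk) (Icc 0 τ) := by
  refine exists_lipschitzOnWith_of_lipschitzNear isCompact_Icc fun t ht => ?_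
  refine D.lipschitzNear_stage hc hr (t := fun t => t) ht
    (LipschitzNear.of_lipschitzWith LipschitzWith.id) (fun s hs => hs.1) k hk
    (fun j hj => ?_) (hadm t ht)
  obtain ⟨K, hK⟩ := hx j hj
  exact ⟨K, Icc 0 τ, self_mem_nhdsWithin, hK⟩

theorem stage_zero (D : Design N n) (t : ℝ) (x : Fin N → Vec n) :
    D.stage c r t x ((0 : Fin N) : ℕ) (0 : Fin N).isLt =
      -(D.κ 0 * transf (outErr c r t (x 0))) • (x 0 - c t) := by
  have : ∀ (i : ℕ) (hi : i < N), i = 0 → D.stage c r t x i hi =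
      -(D.κ 0 * transf (outErr c r t (x 0))) • (x 0 - c t) := by
    rintro i hi rfl
    rw [Design.stage, fin_mk_zero]
  exact this _ _ (by simp)

/-- The first block of an admissible trajectory on `[0, τ)` keeps a distance from the boundary of
the tube, and it is Lipschitz. -/
theorem IsClosedLoop.exists_first_block_bound (hlip : S.LocLipschitz) (hpd : S.UniformlyPosDef)
    (hW : Bornology.IsBounded S.W) (hw : ∀ t, 0 ≤ t → ∀ i, w t i ∈ S.W)
    (hc : ContDiffOn ℝ 1 c (Ici 0)) (hr : ContDiffOn ℝ 1 r (Ici 0))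
    (hrpos : ∀ t ∈ Icc 0 τ, 0 < r t)
    (hx : IsClosedLoop S D c r w x₀ (Ico 0 τ) x)
    (hadm : ∀ t ∈ Ico 0 τ, D.Admissible c r t (x t))
    (hcl : ∀ i z, MapClusterPt z (𝓝[<] τ) (fun t => x t i) → z ∈ S.X i) :
    (∃ ρ < 1, ∀ t ∈ Ico 0 τ, ‖x t 0 - c t‖ ≤ ρ * r t) ∧
      ∃ K, LipschitzOnWith K (fun t => x t 0) (Ico 0 τ) := by
  have hIcc : Icc 0 τ ⊆ Ici 0 := Icc_subset_Ici_self
  obtain ⟨L, hL⟩ := hc.mono hIcc |>.exists_lipschitzOnWith one_ne_zero (convex_Icc 0 τ)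
    isCompact_Icc
  obtain ⟨K, hK⟩ := ((hr.mono hIcc).inv fun t ht => (hrpos t ht).ne').exists_lipschitzOnWith
    one_ne_zero (convex_Icc 0 τ) isCompact_Icc
  obtain ⟨rmax, hrmax⟩ :=
    (isCompact_Icc.image_of_continuousOn (hr.continuousOn.mono hIcc)).bddAbove
  have hrmax' : ∀ t ∈ Ico 0 τ, r t ≤ rmax := fun t ht =>
    hrmax ⟨t, Ico_subset_Icc_self ht, rfl⟩
  have hbd : ∀ j ≤ (0 : Fin N), ∃ C, ∀ t ∈ Ico 0 τ, ‖x t j‖ ≤ C := by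
    intro j hj
    obtain rfl : j = 0 := Fin.ext (by simpa using Fin.le_def.1 hj)
    obtain ⟨C, hC⟩ :=
      (isCompact_Icc.image_of_continuousOn (hc.continuousOn.mono hIcc).norm).bddAbove
    refine ⟨rmax + C, fun t ht => ?_⟩
    rw [← sub_add_cancel (x t 0) (c t)]
    exact (norm_add_le _ _).trans (add_le_add ((hadm t ht).1.le.trans (hrmax' t ht))
      (hC ⟨t, Ico_subset_Icc_self ht, rfl⟩))
  obtain ⟨Λ, hΛ0, hΛ⟩ := hx.exists_hasApproxVelocity hlip hW hw hc hr hcl hadm 0 hbd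
  obtain ⟨b, hb, hG⟩ := hpd 0
  obtain ⟨ρ, hρ1, hρ⟩ := exists_outErr_le (x := fun t => x t 0)
    (G := fun t => S.g 0 (trunc 0 (x t))) (D.κ_pos 0) hb hΛ0
    ((continuous_apply 0).comp_continuousOn hx.cont) (hL.mono Ico_subset_Icc_self)
    (hK.mono Ico_subset_Icc_self) hrmax' (fun t ht => (hadm t ht).1)
    (fun t ht v => mul_norm_sq_le_inner_act (hG _ (S.trunc_mem_dom (hx.mem t ht))) v)
    (fun t ht => by
      have := hΛ t ht
      rwa [stage_zero] at this)
  refine ⟨⟨ρ, hρ1, hρ⟩, hx.exists_lipschitzOnWith hlip hW hw hcl hadm 0 hbd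
    ⟨D.κ 0 * Real.log (2 / (1 - ρ)) * rmax, fun t ht => ?_⟩⟩
  have hrt := hrpos t (Ico_subset_Icc_self ht)
  have he0 : 0 ≤ outErr c r t (x t 0) := div_nonneg (norm_nonneg _) hrt.le
  have he1 : outErr c r t (x t 0) ≤ ρ := (div_le_iff₀ hrt).2 (hρ t ht)
  have h1 : 0 ≤ transf (outErr c r t (x t 0)) :=
    Real.log_nonneg ((one_le_div (by linarith)).2 (by linarith))
  have h2 : transf (outErr c r t (x t 0)) ≤ Real.log (2 / (1 - ρ)) :=
    Real.log_le_log (div_pos (by linarith) (by linarith))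
      (div_le_div₀ zero_le_two (by linarith) (by linarith) (by linarith))
  have hκ := D.κ_pos 0
  have h4 := h1.trans h2
  rw [stage_zero, norm_smul, norm_neg, Real.norm_of_nonneg (by positivity)]
  have h3 := (hadm t ht).1.le.trans (hrmax' t ht)
  gcongr

/-- A later block of an admissible trajectory on `[0, τ)` has normalized errors bounded away from
`1`, and it is Lipschitz, if the blocks before it and its reference signal are Lipschitz. -/
theorem IsClosedLoop.exists_later_block_bound (hlip : S.LocLipschitz) (hpd : S.UniformlyPosDef)
    (hW : Bornology.IsBounded S.W) (hw : ∀ t, 0 ≤ t → ∀ i, w t i ∈ S.W)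
    (hc : ContDiffOn ℝ 1 c (Ici 0)) (hr : ContDiffOn ℝ 1 r (Ici 0))
    (hx : IsClosedLoop S D c r w x₀ (Ico 0 τ) x)
    (hadm : ∀ t ∈ Ico 0 τ, D.Admissible c r t (x t))
    (hcl : ∀ i z, MapClusterPt z (𝓝[<] τ) (fun t => x t i) → z ∈ S.X i) (k : ℕ) (hk : k + 1 < N)
    (hj : ∀ j : Fin N, (j : ℕ) ≤ k → ∃ K, LipschitzOnWith K (fun t => x t j) (Ico 0 τ))
    (hR : ∃ L, LipschitzOnWith L (fun t => D.stage c r t (x t) k (Nat.lt_of_succ_lt hk))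
      (Ico 0 τ)) :
    (∃ ρ < 1, ∀ t ∈ Ico 0 τ, ∀ a, |x t ⟨k + 1, hk⟩ a -
        D.stage c r t (x t) k (Nat.lt_of_succ_lt hk) a| ≤ ρ * D.γ ⟨k + 1, hk⟩ t a) ∧
      ∃ K, LipschitzOnWith K (fun t => x t ⟨k + 1, hk⟩) (Ico 0 τ) := by
  set i : Fin N := ⟨k + 1, hk⟩ with hi
  set R : ℝ → Vec n := fun t => D.stage c r t (x t) k (Nat.lt_of_succ_lt hk) with hRdef
  obtain ⟨L, hR⟩ := hR
  have hRadm : ∀ t ∈ Ico 0 τ, ∀ a, |x t i a - R t a| < D.γ i t a :=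
    fun t ht a => (hadm t ht).2 k hk a
  have hbd : ∀ j ≤ i, ∃ C, ∀ t ∈ Ico 0 τ, ‖x t j‖ ≤ C := by
    intro j hji
    rcases eq_or_ne j i with rfl | hne
    · obtain ⟨C, -, hC⟩ := hR.exists_norm_le
      refine ⟨∑ a, D.p i a + C, fun t ht => ?_⟩
      rw [← sub_add_cancel (x t i) (R t)]
      refine (norm_add_le _ _).trans (add_le_add ((norm_le_sum_abs _).trans ?_) (hC t ht))
      exact Finset.sum_le_sum fun a _ => (hRadm t ht a).le.trans (D.γ_le i ht.1 a)
    · have hjk : (j : ℕ) ≤ k := Nat.lt_succ_iff.1 (Fin.lt_def.1 (lt_of_le_of_ne hji hne))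
      obtain ⟨K, hK⟩ := hj j hjk
      obtain ⟨C, -, hC⟩ := hK.exists_norm_le
      exact ⟨C, hC⟩
  obtain ⟨Λ, hΛ0, hΛ⟩ := hx.exists_hasApproxVelocity hlip hW hw hc hr hcl hadm i hbd
  obtain ⟨b, hb, hG⟩ := hpd i
  obtain ⟨C, hC⟩ := D.exists_abs_transf_le i (x := fun t => x t i) (R := R)
    (G := fun t => S.g i (trunc i (x t))) hb hΛ0
    ((continuous_apply i).comp_continuousOn hx.cont) hR hRadm
    (fun t ht v => mul_norm_sq_le_inner_act (hG _ (S.trunc_mem_dom (hx.mem t ht))) v) hΛ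
  obtain ⟨M, hM⟩ := D.exists_norm_laterStage_le i C
  refine ⟨⟨1 - 2 / (Real.exp C + 1), one_sub_two_div_exp_lt_one C, fun t ht a => ?_⟩,
    hx.exists_lipschitzOnWith hlip hW hw hcl hadm i hbd
      ⟨M, fun t ht => hM t _ _ (hRadm t ht) (hC t ht)⟩⟩
  have h2 := abs_le_of_abs_transf_le (D.abs_err_lt_one (hRadm t ht a)) (hC t ht a)
  rwa [Design.err, abs_div, abs_of_pos (D.γ_pos i t a), div_le_iff₀ (D.γ_pos i t a)] at h2

/-- An admissible trajectory on `[0, τ)` whose later blocks do not leave the state sets in the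
limit converges to an admissible state. The proof goes through the stages: if the reference signal
of a stage is Lipschitz, the barrier of the stage keeps its output bounded, hence its state block is
Lipschitz and has an admissible limit, hence its output is Lipschitz, which is the reference signal
of the next stage. -/
theorem IsClosedLoop.exists_tendsto_admissible (hlip : S.LocLipschitz) (hpd : S.UniformlyPosDef)
    (hW : Bornology.IsBounded S.W) (hw : ∀ t, 0 ≤ t → ∀ i, w t i ∈ S.W)
    (hc : ContDiffOn ℝ 1 c (Ici 0)) (hr : ContDiffOn ℝ 1 r (Ici 0)) (hτ : 0 < τ)
    (hrpos : ∀ t ∈ Icc 0 τ, 0 < r t) (htube : tube c r τ ⊆ S.X 0)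
    (hx : IsClosedLoop S D c r w x₀ (Ico 0 τ) x)
    (hadm : ∀ t ∈ Ico 0 τ, D.Admissible c r t (x t))
    (hcl : ∀ i, i ≠ 0 → ∀ z, MapClusterPt z (𝓝[<] τ) (fun t => x t i) → z ∈ S.X i) :
    ∃ z, Tendsto x (𝓝[<] τ) (𝓝 z) ∧ D.Admissible c r τ z := by
  have hIcc : Icc 0 τ ⊆ Ici 0 := Icc_subset_Ici_self
  have hτI : τ ∈ Icc 0 τ := ⟨hτ.le, le_rfl⟩
  have hcc := hc.continuousOn.mono hIcc
  have hrc := hr.continuousOn.mono hIcc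
  have hIco : Ico 0 τ ∈ 𝓝[<] τ := Ico_mem_nhdsLT hτ
  have hle : 𝓝[<] τ ≤ 𝓝[Icc 0 τ] τ :=
    le_inf nhdsWithin_le_nhds (le_principal_iff.2 (mem_of_superset hIco Ico_subset_Icc_self))
  -- the cluster points of the first block lie in the tube
  have hcl' : ∀ i z, MapClusterPt z (𝓝[<] τ) (fun t => x t i) → z ∈ S.X i := by
    intro i z hz
    by_cases hi : i = 0
    · subst hi
      obtain ⟨U, hU, hUz⟩ := mapClusterPt_iff_ultrafilter.1 hz
      refine htube (le_of_tendsto_of_tendsto ((hUz.sub ((hcc τ hτI).mono_left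
        (hU.trans hle))).norm) ((hrc τ hτI).mono_left (hU.trans hle)) ?_)
      filter_upwards [hU hIco] with t ht using (hadm t ht).1.le
    · exact hcl i hi z hz
  -- the trajectory, extended by its left limit at `τ` (where that exists)
  set y : ℝ → Fin N → Vec n :=
    Function.update x τ fun k => limUnder (𝓝[<] τ) fun t => x t k with hy
  have hyx : EqOn y x (Ico 0 τ) := fun t ht => Function.update_of_ne ht.2.ne _ _
  have hylip : ∀ i, (∃ K, LipschitzOnWith K (fun t => x t i) (Ico 0 τ)) →
      ∃ K, LipschitzOnWith K (fun t => y t i) (Icc 0 τ) := fun i ⟨K, hK⟩ =>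
    exists_lipschitzOnWith_Icc_of_Ico hτ hK (fun t ht => by rw [hyx ht]) (by simp [hy])
  have hstage : ∀ k (hk : k < N),
      (∀ j : Fin N, (j : ℕ) ≤ k → ∃ K, LipschitzOnWith K (fun t => y t j) (Icc 0 τ)) →
      D.AdmissibleUpTo c r τ (y τ) k →
      ∃ K, LipschitzOnWith K (fun t => D.stage c r t (y t) k hk) (Icc 0 τ) := by
    intro k hk hj hk'
    refine D.exists_lipschitzOnWith_stage hc hr k hk hj fun t ht => ?_
    rcases ht.2.eq_or_lt with rfl | h
    · exact hk'
    · rw [hyx ⟨ht.1, h⟩]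
      exact (hadm t ⟨ht.1, h⟩).upTo k
  have main : ∀ k (_ : k < N),
      (∀ j : Fin N, (j : ℕ) ≤ k → ∃ K, LipschitzOnWith K (fun t => y t j) (Icc 0 τ)) ∧
      D.AdmissibleUpTo c r τ (y τ) k := by
    intro k
    induction k with
    | zero =>
      intro hk
      obtain ⟨⟨ρ, hρ1, hρ⟩, hx0⟩ :=
        hx.exists_first_block_bound hlip hpd hW hw hc hr hrpos hadm hcl'
      obtain ⟨K', hK'⟩ := hylip 0 hx0
      refine ⟨fun j hj => ?_, ?_, fun j hj i hj0 => absurd hj0 (by omega)⟩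
      · obtain rfl : j = 0 := Fin.ext (by simpa using hj)
        exact ⟨K', hK'⟩
      · have hrτ := hrpos τ hτI
        have h1 : ‖y τ 0 - c τ‖ ≤ ρ * r τ :=
          le_of_le_Ico (f := fun t => ‖y t 0 - c t‖) (g := fun t => ρ * r t) hτ
            (hK'.continuousOn.sub hcc).norm (continuousOn_const.mul hrc)
            fun t ht => by
              rw [hyx ht]
              exact hρ t ht
        nlinarith
    | succ k ih =>
      intro hk
      obtain ⟨hj, hadmk⟩ := ih (Nat.lt_of_succ_lt hk)
      obtain ⟨L', hL'⟩ := hstage k (Nat.lt_of_succ_lt hk) hj hadmk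
      obtain ⟨⟨ρ, hρ1, hρ⟩, hxi⟩ := hx.exists_later_block_bound hlip hpd hW hw hc hr hadm hcl' k hk
        (fun j hjk => (hj j hjk).imp fun K hK s hs t ht => by
          have := hK (Ico_subset_Icc_self hs) (Ico_subset_Icc_self ht)
          simpa only [hyx hs, hyx ht] using this)
        ⟨L', fun s hs t ht => by
          have := hL' (Ico_subset_Icc_self hs) (Ico_subset_Icc_self ht)
          simpa only [hyx hs, hyx ht] using this⟩
      obtain ⟨K', hK'⟩ := hylip _ hxi
      refine ⟨fun j hjk => ?_, hadmk.1, fun j hjN a hjk => ?_⟩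
      · rcases Nat.le_succ_iff.1 hjk with h | h
        · exact hj j h
        · obtain rfl : j = ⟨k + 1, hk⟩ := Fin.ext h
          exact ⟨K', hK'⟩
      · rcases Nat.le_succ_iff.1 hjk with h | h
        · exact hadmk.2 j hjN a h
        · obtain rfl : j = k := Nat.succ_injective h
          have hproj : Continuous fun v : Vec n => v a :=
            (EuclideanSpace.proj (𝕜 := ℝ) a).continuous
          have h1 := le_of_le_Ico (f := fun t => |y t ⟨j + 1, hk⟩ a -
              D.stage c r t (y t) j (Nat.lt_of_succ_lt hk) a|)
            (g := fun t => ρ * D.γ ⟨j + 1, hk⟩ t a) hτ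
            ((hproj.comp_continuousOn hK'.continuousOn).sub
              (hproj.comp_continuousOn hL'.continuousOn)).abs
            (continuousOn_const.mul (D.contDiff_γ _ a).continuous.continuousOn)
            fun t ht => by
              rw [hyx ht]
              exact hρ t ht a
          refine h1.trans_lt ?_
          exact mul_lt_of_lt_one_left (D.γ_pos _ τ a) hρ1
  have hN : N - 1 < N := Nat.sub_one_lt (NeZero.ne N)
  obtain ⟨hj, hadmN⟩ := main (N - 1) hN
  refine ⟨y τ, tendsto_pi_nhds.2 fun i => ?_, hadmN.admissible (by omega)⟩
  obtain ⟨K', hK'⟩ := hj i (by omega)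
  refine ((hK'.continuousOn τ hτI).mono_left hle).congr' ?_
  filter_upwards [hIco] with t ht
  rw [hyx ht]

end Limit

/-! ### Invariance of the admissible set -/

section Invariance

variable {N n : ℕ} [NeZero N] {S : PureFeedbackSystem N n} {D : Design N n} {c : ℝ → Vec n}
  {r : ℝ → ℝ} {w : ℝ → Fin N → Vec n} {x₀ : Fin N → Vec n} {x : ℝ → Fin N → Vec n} {T : ℝ}

theorem IsClosedLoop.mono {J J' : Set ℝ} (hx : IsClosedLoop S D c r w x₀ J x) (h : J' ⊆ J) :
    IsClosedLoop S D c r w x₀ J' x :=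
  ⟨hx.init, fun t ht => hx.mem t (h ht), hx.cont.mono h, fun t ht => hx.integrable t (h ht),
    fun t ht => hx.eq t (h ht)⟩

/-- At the first time at which the control law would not be well defined, the trajectory has an
admissible limit, a contradiction. -/
theorem IsClosedLoop.admissible (hlip : S.LocLipschitz) (hpd : S.UniformlyPosDef)
    (hW : Bornology.IsBounded S.W) (hw : ∀ t, 0 ≤ t → ∀ i, w t i ∈ S.W)
    (hc : ContDiffOn ℝ 1 c (Ici 0)) (hr : ContDiffOn ℝ 1 r (Ici 0))
    (hrpos : ∀ t ∈ Icc 0 T, 0 < r t) (htube : ∀ t ∈ Icc 0 T, tube c r t ⊆ S.X 0)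
    (h0 : D.Admissible c r 0 x₀) (hx : IsClosedLoop S D c r w x₀ (Icc 0 T) x) :
    ∀ t ∈ Icc 0 T, D.Admissible c r t (x t) := by
  by_contra! hne
  set bad : Set ℝ := {t | t ∈ Icc 0 T ∧ ¬D.Admissible c r t (x t)} with hbad
  have hne' : bad.Nonempty := hne
  have hbdd : BddBelow bad := ⟨0, fun t ht => ht.1.1⟩
  set τ := sInf bad with hτdef
  have hτ0 : 0 ≤ τ := le_csInf hne' fun t ht => ht.1.1
  have hτT : τ ≤ T := (csInf_le hbdd hne'.some_mem).trans hne'.some_mem.1.2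
  have hτI : τ ∈ Icc 0 T := ⟨hτ0, hτT⟩
  have hadm : ∀ t ∈ Ico 0 τ, D.Admissible c r t (x t) := fun t ht => by
    by_contra h
    exact notMem_of_lt_csInf ht.2 hbdd ⟨⟨ht.1, ht.2.le.trans hτT⟩, h⟩
  have hτbad : ¬D.Admissible c r τ (x τ) := by
    intro h
    have hmem : ((τ, x τ) : ℝ × (Fin N → Vec n)) ∈ Icc 0 T ×ˢ (univ : Set (Fin N → Vec n)) :=
      ⟨hτI, mem_univ _⟩
    have h1 := D.eventually_admissible hc hr (t := Prod.fst) (x := Prod.snd) hmem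
      (LipschitzNear.of_lipschitzWith LipschitzWith.prod_fst) (fun p hp => hp.1.1)
      (fun j => LipschitzNear.of_lipschitzWith
        ((LipschitzWith.eval j).comp LipschitzWith.prod_snd)) h
    have h2 : Tendsto (fun t => (t, x t)) (𝓝[Icc 0 T] τ) (𝓝[Icc 0 T ×ˢ univ] (τ, x τ)) := by
      refine tendsto_nhdsWithin_iff.2 ⟨continuousWithinAt_id.prodMk (hx.cont τ hτI), ?_⟩
      filter_upwards [self_mem_nhdsWithin] with t ht using ⟨ht, mem_univ _⟩
    obtain ⟨e, he, h3⟩ := Metric.mem_nhdsWithin_iff.1 (h2.eventually h1)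
    obtain ⟨t, ht, hte⟩ := exists_lt_of_csInf_lt hne' (show τ < τ + e by linarith)
    have htτ : τ ≤ t := csInf_le hbdd ht
    refine ht.2 (h3 ⟨?_, ht.1⟩)
    rw [Metric.mem_ball, Real.dist_eq, abs_of_nonneg (by linarith)]
    linarith
  have hτpos : 0 < τ := by
    refine lt_of_le_of_ne hτ0 fun h => hτbad ?_
    rw [← h, hx.init]
    exact h0
  have hlim : Tendsto x (𝓝[<] τ) (𝓝 (x τ)) := by
    refine (hx.cont τ hτI).mono_left (le_inf nhdsWithin_le_nhds (le_principal_iff.2 ?_))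
    exact mem_of_superset (Ico_mem_nhdsLT hτpos) fun t ht => ⟨ht.1, ht.2.le.trans hτT⟩
  obtain ⟨z, hz, hzadm⟩ := IsClosedLoop.exists_tendsto_admissible hlip hpd hW hw hc hr hτpos
    (fun t ht => hrpos t ⟨ht.1, ht.2.trans hτT⟩) (htube τ hτI)
    (hx.mono fun t ht => ⟨ht.1, ht.2.le.trans hτT⟩) hadm (fun i _ z hz => by
      obtain ⟨U, hU, hUz⟩ := mapClusterPt_iff_ultrafilter.1 hz
      rw [tendsto_nhds_unique hUz ((tendsto_pi_nhds.1 hlim i).mono_left hU)]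
      exact hx.mem τ hτI i)
  rw [tendsto_nhds_unique hz hlim] at hzadm
  exact hτbad hzadm

end Invariance

/-! ### Existence of trajectories -/

section Existence

variable {N n : ℕ} {S : PureFeedbackSystem N n} {D : Design N n} {c : ℝ → Vec n}
  {r : ℝ → ℝ} {w : ℝ → Fin N → Vec n} {x₀ : Fin N → Vec n} {T : ℝ}

/-- The integral of the disturbance. Since the disturbance enters additively, subtracting this from
a trajectory leaves a solution of an equation whose right-hand side is continuous in time. -/
noncomputable def cumulative (w : ℝ → Fin N → Vec n) (t : ℝ) : Fin N → Vec n :=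
  fun i => ∫ s in (0 : ℝ)..t, w s i

theorem intervalIntegrable_disturbance (hW : Bornology.IsBounded S.W)
    (hwm : ∀ i, Measurable fun t => w t i) (hw : ∀ t, 0 ≤ t → ∀ i, w t i ∈ S.W) (i : Fin N)
    {s t : ℝ} (hs : 0 ≤ s) (ht : 0 ≤ t) : IntervalIntegrable (fun q => w q i) volume s t := by
  obtain ⟨M, hM⟩ := isBounded_iff_forall_norm_le.1 hW
  rw [intervalIntegrable_iff]
  refine IntegrableOn.of_bound (by simp [uIoc]) (hwm i).aestronglyMeasurable M ?_
  filter_upwards [ae_restrict_mem measurableSet_uIoc] with q hq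
  exact hM _ (hw q ((le_min hs ht).trans (mem_Ioc.1 hq).1.le) i)

theorem exists_lipschitzOnWith_cumulative (hW : Bornology.IsBounded S.W)
    (hwm : ∀ i, Measurable fun t => w t i) (hw : ∀ t, 0 ≤ t → ∀ i, w t i ∈ S.W) :
    ∃ K, LipschitzOnWith K (cumulative w) (Ici 0) := by
  obtain ⟨M, hM⟩ := isBounded_iff_forall_norm_le.1 hW
  refine ⟨⟨|M|, abs_nonneg M⟩, LipschitzOnWith.of_dist_le_mul fun s hs t ht => ?_⟩
  refine (dist_pi_le_iff (mul_nonneg (NNReal.coe_nonneg _) dist_nonneg)).2 fun i => ?_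
  have h0 : (0 : ℝ) ∈ Ici (0 : ℝ) := self_mem_Ici
  rw [dist_eq_norm, cumulative, cumulative, intervalIntegral.integral_interval_sub_left
    (intervalIntegrable_disturbance hW hwm hw i h0 hs)
    (intervalIntegrable_disturbance hW hwm hw i h0 ht), Real.dist_eq]
  refine intervalIntegral.norm_integral_le_of_norm_le_const fun q hq => ?_
  exact (hM _ (hw q ((le_min ht hs).trans (mem_Ioc.1 hq).1.le) i)).trans (le_abs_self M)

theorem lipschitzNear_add_cumulative (hW : Bornology.IsBounded S.W)
    (hwm : ∀ i, Measurable fun t => w t i) (hw : ∀ t, 0 ≤ t → ∀ i, w t i ∈ S.W)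
    {p : ℝ × (Fin N → Vec n)}
    (hp : p ∈ Icc 0 T ×ˢ (univ : Set (Fin N → Vec n))) :
    LipschitzNear (fun q : ℝ × (Fin N → Vec n) => q.2 + cumulative w q.1) (Icc 0 T ×ˢ univ) p := by
  obtain ⟨K, hK⟩ := exists_lipschitzOnWith_cumulative hW hwm hw
  refine (LipschitzNear.of_lipschitzWith LipschitzWith.prod_snd).add ?_ hp
  exact LipschitzNear.comp (f := Prod.fst) (u := Ici 0) ⟨K, Ici 0, self_mem_nhdsWithin, hK⟩
    (LipschitzNear.of_lipschitzWith LipschitzWith.prod_fst) hp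
    (eventually_mem_nhdsWithin.mono fun q hq => hq.1.1)

theorem lipschitzNear_add_cumulative_apply (hW : Bornology.IsBounded S.W)
    (hwm : ∀ i, Measurable fun t => w t i) (hw : ∀ t, 0 ≤ t → ∀ i, w t i ∈ S.W)
    {p : ℝ × (Fin N → Vec n)} (hp : p ∈ Icc 0 T ×ˢ (univ : Set (Fin N → Vec n))) (j : Fin N) :
    LipschitzNear (fun q : ℝ × (Fin N → Vec n) => (q.2 + cumulative w q.1) j)
      (Icc 0 T ×ˢ univ) p :=
  LipschitzNear.contDiffAt_comp (g := fun v : Fin N → Vec n => v j)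
    (contDiff_apply ℝ (Vec n) j).contDiffAt (lipschitzNear_add_cumulative hW hwm hw hp) hp

variable [NeZero N]

/-- The closed-loop vector field after subtraction of the integrated disturbance. -/
noncomputable def shiftedField (S : PureFeedbackSystem N n) (D : Design N n) (c : ℝ → Vec n)
    (r : ℝ → ℝ) (w : ℝ → Fin N → Vec n) (p : ℝ × (Fin N → Vec n)) : Fin N → Vec n :=
  fun i => S.rhs (p.2 + cumulative w p.1) (D.control c r p.1 (p.2 + cumulative w p.1)) 0 i

/-- The times and shifted states that are admissible and whose later blocks are interior points of
the state sets. -/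
def shiftedDomain (S : PureFeedbackSystem N n) (D : Design N n) (c : ℝ → Vec n)
    (r : ℝ → ℝ) (w : ℝ → Fin N → Vec n) (T : ℝ) : Set (ℝ × (Fin N → Vec n)) :=
  {p | p.1 ∈ Icc 0 T ∧ D.Admissible c r p.1 (p.2 + cumulative w p.1) ∧
    ∀ k, k ≠ 0 → (p.2 + cumulative w p.1) k ∈ interior (S.X k)}

theorem mem_of_mem_shiftedDomain (htube : ∀ t ∈ Icc 0 T, tube c r t ⊆ S.X 0)
    {p : ℝ × (Fin N → Vec n)} (hp : p ∈ shiftedDomain S D c r w T) (i : Fin N) :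
    (p.2 + cumulative w p.1) i ∈ S.X i := by
  by_cases hi : i = 0
  · subst hi
    exact htube _ hp.1 hp.2.1.1.le
  · exact interior_subset (hp.2.2 i hi)

theorem eventually_mem_shiftedDomain (hW : Bornology.IsBounded S.W)
    (hwm : ∀ i, Measurable fun t => w t i) (hw : ∀ t, 0 ≤ t → ∀ i, w t i ∈ S.W)
    (hc : ContDiffOn ℝ 1 c (Ici 0)) (hr : ContDiffOn ℝ 1 r (Ici 0))
    {p : ℝ × (Fin N → Vec n)} (hp : p ∈ shiftedDomain S D c r w T) :
    ∀ᶠ q in 𝓝[Icc 0 T ×ˢ univ] p, q ∈ shiftedDomain S D c r w T := by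
  have hmem : p ∈ Icc 0 T ×ˢ (univ : Set (Fin N → Vec n)) := ⟨hp.1, mem_univ _⟩
  have hcoord := lipschitzNear_add_cumulative_apply (T := T) hW hwm hw hmem
  refine (eventually_mem_nhdsWithin.mono fun q hq => hq.1).and (Eventually.and ?_ ?_)
  · exact D.eventually_admissible hc hr (t := Prod.fst)
      (x := fun q : ℝ × (Fin N → Vec n) => q.2 + cumulative w q.1) hmem
      (LipschitzNear.of_lipschitzWith LipschitzWith.prod_fst) (fun q hq => hq.1.1) hcoord hp.2.1
  · refine eventually_all.2 fun k => ?_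
    by_cases hk : k = 0
    · exact Eventually.of_forall fun q h => absurd hk h
    · have := ((hcoord k).continuousWithinAt hmem).eventually
        (isOpen_interior.mem_nhds (hp.2.2 k hk))
      exact this.mono fun q hq _ => hq

theorem lipschitzNear_shiftedField (hlip : S.LocLipschitz) (hW : Bornology.IsBounded S.W)
    (hwm : ∀ i, Measurable fun t => w t i) (hw : ∀ t, 0 ≤ t → ∀ i, w t i ∈ S.W)
    (hc : ContDiffOn ℝ 1 c (Ici 0)) (hr : ContDiffOn ℝ 1 r (Ici 0))
    (htube : ∀ t ∈ Icc 0 T, tube c r t ⊆ S.X 0)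
    {p : ℝ × (Fin N → Vec n)} (hp : p ∈ shiftedDomain S D c r w T) :
    LipschitzNear (shiftedField S D c r w) (Icc 0 T ×ˢ univ) p := by
  have hmem : p ∈ Icc 0 T ×ˢ (univ : Set (Fin N → Vec n)) := ⟨hp.1, mem_univ _⟩
  refine LipschitzNear.pi fun i => D.lipschitzNear_rhs hlip hc hr (t := Prod.fst)
    (x := fun q : ℝ × (Fin N → Vec n) => q.2 + cumulative w q.1) hmem
    (LipschitzNear.of_lipschitzWith LipschitzWith.prod_fst) (fun q hq => hq.1.1)
    (lipschitzNear_add_cumulative_apply hW hwm hw hmem) hp.2.1 ?_ i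
  exact (eventually_mem_shiftedDomain hW hwm hw hc hr hp).mono fun q hq j =>
    mem_of_mem_shiftedDomain htube hq j

/-- Solutions of the shifted equation give closed-loop trajectories. -/
theorem isClosedLoop_of_isSolution (hlip : S.LocLipschitz) (hW : Bornology.IsBounded S.W)
    (hwm : ∀ i, Measurable fun t => w t i) (hw : ∀ t, 0 ≤ t → ∀ i, w t i ∈ S.W)
    (hc : ContDiffOn ℝ 1 c (Ici 0)) (hr : ContDiffOn ℝ 1 r (Ici 0))
    (htube : ∀ t ∈ Icc 0 T, tube c r t ⊆ S.X 0) {J : Set ℝ} (hJ : J ⊆ Ici 0) (h0 : 0 ∈ J)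
    {y : ℝ → Fin N → Vec n} (hy : ContinuousOn y J)
    (hsol : ∀ t ∈ J, IsSolution (shiftedField S D c r w) (shiftedDomain S D c r w T) x₀ t y) :
    IsClosedLoop S D c r w x₀ J fun t => y t + cumulative w t := by
  obtain ⟨K, hK⟩ := exists_lipschitzOnWith_cumulative hW hwm hw
  have hfield : ∀ t ∈ J, ∀ i,
      IntervalIntegrable (fun s => shiftedField S D c r w (s, y s) i) volume 0 t := by
    intro t ht i
    refine ContinuousOn.intervalIntegrable_of_Icc (hJ ht) ?_
    refine (continuous_apply i).comp_continuousOn fun s hs => ?_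
    have hs' := (hsol t ht).mem s hs
    have hmem : (s, y s) ∈ Icc 0 T ×ˢ (univ : Set (Fin N → Vec n)) := ⟨hs'.1, mem_univ _⟩
    exact ContinuousWithinAt.comp (f := fun s => (s, y s))
      ((lipschitzNear_shiftedField hlip hW hwm hw hc hr htube hs').continuousWithinAt hmem)
      (continuousWithinAt_id.prodMk ((hsol t ht).cont s hs))
      fun q hq => ⟨((hsol t ht).mem q hq).1, mem_univ _⟩
  have hrhs : ∀ s i, S.rhs (y s + cumulative w s)
      (D.control c r s (y s + cumulative w s)) (w s) i =
      shiftedField S D c r w (s, y s) i + w s i := fun s i => by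
    simp [shiftedField, PureFeedbackSystem.rhs]
  have hwint : ∀ t ∈ J, ∀ i, IntervalIntegrable (fun q => w q i) volume 0 t := fun t ht i =>
    intervalIntegrable_disturbance hW hwm hw i le_rfl (hJ ht)
  refine ⟨?_, fun t ht i => ?_, hy.add (hK.continuousOn.mono hJ), fun t ht i => ?_,
    fun t ht i => ?_⟩
  · ext1 i
    simp [(hsol 0 h0).init, cumulative]
  · exact mem_of_mem_shiftedDomain htube ((hsol t ht).mem t ⟨hJ ht, le_rfl⟩) i
  · simp only [hrhs]
    exact (hfield t ht i).add (hwint t ht i)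
  · simp only [hrhs]
    rw [intervalIntegral.integral_add (hfield t ht i) (hwint t ht i),
      intervalIntegral.integral_eq_sub_of_hasDeriv_right_of_le (f := fun s => y s i) (hJ ht)
        ((continuous_apply i).comp_continuousOn (hsol t ht).cont) (fun s hs => ?_)
        (hfield t ht i), (hsol t ht).init]
    · simp only [Pi.add_apply, cumulative]
      abel
    · exact hasDerivWithinAt_pi.1
        (((hsol t ht).deriv s ⟨hs.1.le, hs.2⟩).mono Ioi_subset_Ici_self) i

/-- A closed-loop trajectory exists up to time `T`, or up to a time `τ` at which a later block
accumulates outside the interior of its state set. -/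
theorem exists_isClosedLoop (hlip : S.LocLipschitz) (hpd : S.UniformlyPosDef)
    (hW : Bornology.IsBounded S.W)
    (hwm : ∀ i, Measurable fun t => w t i) (hw : ∀ t, 0 ≤ t → ∀ i, w t i ∈ S.W)
    (hc : ContDiffOn ℝ 1 c (Ici 0)) (hr : ContDiffOn ℝ 1 r (Ici 0)) (hT : 0 ≤ T)
    (hrpos : ∀ t ∈ Icc 0 T, 0 < r t) (htube : ∀ t ∈ Icc 0 T, tube c r t ⊆ S.X 0)
    (h0 : D.Admissible c r 0 x₀) (hint : ∀ k, k ≠ 0 → x₀ k ∈ interior (S.X k)) :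
    (∃ x, IsClosedLoop S D c r w x₀ (Icc 0 T) x) ∨
      ∃ τ ∈ Ioc 0 T, ∃ x, IsClosedLoop S D c r w x₀ (Ico 0 τ) x ∧
        ∃ k : Fin N, k ≠ 0 ∧ ∃ z, z ∉ interior (S.X k) ∧
          MapClusterPt z (𝓝[<] τ) fun t => x t k := by
  have hw0 : cumulative w 0 = 0 := by
    ext1 i
    simp [cumulative]
  have hmem0 : ((0 : ℝ), x₀) ∈ shiftedDomain S D c r w T := by
    refine ⟨⟨le_rfl, hT⟩, ?_, ?_⟩ <;> simp only [hw0, add_zero]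
    · exact h0
    · exact hint
  rcases exists_maximal_solution hT (fun p hp => ⟨hp.1, mem_univ _⟩)
    (fun p hp => eventually_mem_shiftedDomain hW hwm hw hc hr hp)
    (fun p hp => lipschitzNear_shiftedField hlip hW hwm hw hc hr htube hp) hmem0 with
    ⟨y, hy⟩ | ⟨τ, hτ, y, hy, hnot⟩
  · exact Or.inl ⟨_, isClosedLoop_of_isSolution hlip hW hwm hw hc hr htube Icc_subset_Ici_self
      ⟨le_rfl, hT⟩ hy.cont fun t ht => hy.mono ht.2⟩
  · have hx := isClosedLoop_of_isSolution hlip hW hwm hw hc hr htube Ico_subset_Ici_self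
      ⟨le_rfl, hτ.1⟩ (continuousOn_Ico_of_forall_Icc fun b hb => (hy b hb).cont) hy
    refine Or.inr ⟨τ, hτ, _, hx, ?_⟩
    by_contra! hcl
    have hτI : τ ∈ Icc 0 T := ⟨hτ.1.le, hτ.2⟩
    obtain ⟨z, hz, hzadm⟩ := hx.exists_tendsto_admissible hlip hpd hW hw hc hr hτ.1
      (fun t ht => hrpos t ⟨ht.1, ht.2.trans hτ.2⟩) (htube τ hτI)
      (fun t ht => ((hy t ht).mem t ⟨ht.1, le_rfl⟩).2.1)
      (fun k hk z hz => by
        by_contra h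
        exact hcl k hk z (fun h' => h (interior_subset h')) hz)
    obtain ⟨K, hK⟩ := exists_lipschitzOnWith_cumulative hW hwm hw
    have hcum : Tendsto (cumulative w) (𝓝[<] τ) (𝓝 (cumulative w τ)) := by
      refine (hK.continuousOn τ hτ.1.le).mono_left (le_inf nhdsWithin_le_nhds
        (le_principal_iff.2 (mem_of_superset (Ico_mem_nhdsLT hτ.1) Ico_subset_Ici_self)))
    refine hnot (z - cumulative w τ) ?_ ⟨hτI, ?_, fun k hk => ?_⟩
    · simpa using hz.sub hcum
    · simpa using hzadm
    · by_contra h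
      simp only [sub_add_cancel] at h
      exact hcl k hk (z k) h (tendsto_pi_nhds.1 hz k).mapClusterPt

end Existence

end TubeControl

theorem theorem2 {N n : ℕ} [NeZero N] (S : TubeControl.PureFeedbackSystem N n)
    (hlip : S.LocLipschitz) (hpd : S.UniformlyPosDef) (hW : Bornology.IsBounded S.W)
    (task : TubeControl.TRASTask (S.X 0)) (c : ℝ → TubeControl.Vec n) (r : ℝ → ℝ)
    (hstt : TubeControl.IsSTT task c r) (D : TubeControl.Design N n)
    (w : ℝ → Fin N → TubeControl.Vec n) (hwm : ∀ i, Measurable fun t => w t i)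
    (hw : ∀ t, 0 ≤ t → ∀ i, w t i ∈ S.W)
    (x₀ : Fin N → TubeControl.Vec n) (hx₀ : ∀ i, x₀ i ∈ S.X i)
    -- the initial output lies in the tube (off its boundary, where the control is undefined), and
    -- the initial widths `p` of the performance bounds are chosen accordingly
    (hinit : ‖x₀ 0 - c 0‖ < r 0)
    (hp : ∀ (k : ℕ) (h : k + 1 < N) (i : Fin n),
      |x₀ ⟨k + 1, h⟩ i - D.stage c r 0 x₀ k (Nat.lt_of_succ_lt h) i| < D.p ⟨k + 1, h⟩ i) :
    -- along every closed-loop trajectory the control law is well defined and the output stays in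
    -- the tube; a trajectory on all of `[0, tc]` satisfies the task
    (∀ T ∈ Set.Icc 0 task.tc, ∀ x, TubeControl.IsClosedLoop S D c r w x₀ (Set.Icc 0 T) x →
      (∀ t ∈ Set.Icc 0 T, D.Admissible c r t (x t) ∧ x t 0 ∈ TubeControl.tube c r t) ∧
      (T = task.tc → task.Satisfies fun t => x t 0)) ∧
    -- a closed-loop trajectory exists up to time `tc`, unless some block `x_k`, `k ≥ 2`, runs out
    -- of the interior of its state set before (impossible if that set is the whole space)
    ((∀ k : Fin N, k ≠ 0 → x₀ k ∈ interior (S.X k)) →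
      (∃ x, TubeControl.IsClosedLoop S D c r w x₀ (Set.Icc 0 task.tc) x) ∨
      ∃ τ ∈ Set.Ioc 0 task.tc, ∃ x, TubeControl.IsClosedLoop S D c r w x₀ (Set.Ico 0 τ) x ∧
        ∃ k : Fin N, k ≠ 0 ∧ ∃ z, z ∉ interior (S.X k) ∧
          MapClusterPt z (nhdsWithin τ (Set.Iio τ)) fun t => x t k) := by
  have hT := task.tc_pos.le
  have htube : ∀ t ∈ Set.Icc 0 task.tc, TubeControl.tube c r t ⊆ S.X 0 := fun t ht =>
    (hstt.safe t ht).trans Set.sdiff_subset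
  have hadm0 : D.Admissible c r 0 x₀ := ⟨hinit, fun k h i => by
    rw [D.γ_zero]
    exact hp k h i⟩
  refine ⟨fun T hTI x hx => ?_, fun hint => ?_⟩
  · have hsub : Set.Icc 0 T ⊆ Set.Icc 0 task.tc := Set.Icc_subset_Icc_right hTI.2
    have hadm := hx.admissible hlip hpd hW hw hstt.contDiff_center hstt.contDiff_radius
      (fun t ht => hstt.radius_pos t (hsub ht)) (fun t ht => htube t (hsub ht)) hadm0
    have htraj : ∀ t ∈ Set.Icc 0 T, x t 0 ∈ TubeControl.tube c r t := fun t ht =>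
      (hadm t ht).1.le
    refine ⟨fun t ht => ⟨hadm t ht, htraj t ht⟩, ?_⟩
    rintro rfl
    exact ⟨hstt.initial (htraj 0 ⟨le_rfl, hT⟩), hstt.target (htraj _ ⟨hT, le_rfl⟩),
      fun s hs => hstt.safe s hs (htraj s hs)⟩
  · exact TubeControl.exists_isClosedLoop hlip hpd hW hwm hw hstt.contDiff_center
      hstt.contDiff_radius hT hstt.radius_pos htube hadm0 hint
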